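/- Throughout, $E$ is a Hausdorff, sequentially complete, barreled locally convex space over $\mathbb C$; $L(E)$ is the space of continuous linear operators on $E$ with the topology of uniform convergence on bounded sets; $\mathcal D=C_0^\infty(\mathbb R)$, with its usual topology, and $\mathcal D_\Omega=\{\varphi\in\mathcal D:\operatorname{supp}\varphi\subseteq\Omega\}$. Integrals of vector-valued functions are understood through continuous linear functionals. Let $(\varphi*_0\psi)(t)=\int_0^t\varphi(t-s)\psi(s)\,ds$, and $g_k(t)=t^{k-1}/(k-1)!$ for $k\in\mathbb N=\{1,2,\dots\}$. Let $C\in L(E)$, not necessarily injective. A pre-(C-DS) is a continuous linear map $\mathcal G:\mathcal D\to L(E)$, supported in $[0,\infty)$, with $C\mathcal G(\varphi)=\mathcal G(\varphi)C$ and $\mathcal G(\varphi*_0\psi)C=\mathcal G(\varphi)\mathcal G(\psi)$ for all $\varphi,\psi\in\mathcal D$. Its kernel space is $N=\mathcal N(\mathcal G)=\bigcap_{\varphi\in\mathcal D_{[0,\infty)}}\ker\mathcal G(\varphi)$, and its generator is the (possibly multivalued) linear operator $$\mathcal A=\{(x,y)\in E\times E:\ \mathcal G(-\varphi')x=\mathcal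 G(\varphi)y\ \text{ for all }\varphi\in\mathcal D_{[0,\infty)}\}.$$ $\mathcal G$ is of finite order if for every $\tau>0$ there are an integer $n\ge0$ and a continuous $f:[-\tau,\tau]\to L(E)$ with $\mathcal G(\varphi)=(-1)^n\int_{-\tau}^{\tau}\varphi^{(n)}(t)f(t)\,dt$ for all $\varphi\in\mathcal D_{(-\tau,\tau)}$. A topological vector space $X$ is admissible if every continuous linear $F:\mathcal D\to X$ with support in $\{0\}$ is a finite sum $\sum_{j=0}^m\delta^{(j)}\otimes x_j$, $x_j\in X$, i.e. $F(\varphi)=\sum_{j=0}^m(-1)^j\varphi^{(j)}(0)x_j$. **Theorem.** Let $\mathcal G$ be a pre-(C-DS) of finite order with generator $\mathcal A$. Then for every $\tau>0$ there exist $n=n_\tau\in\mathbb N$ and a family $(S(t))_{t\in[0,\tau)}\subseteq L(E)$, with $t\mapsto S(t)x$ continuous on $[0,\tau)$ for every $x\in E$, such that: 1. $(S(t))_{t\in[0,\tau)}$ is a local $n$-times integrated $C$-semigroup: $S(t)C=CS(t)$ for $t\in[0,\tau)$, and for all $x\in E$ and $t,s\in[0,\tau)$ with $t+s<\tau$, $$S(t)S(s)x=\Bigl[\int_0^{t+s}-\int_0^t-\int_0^s\Bigr]g_n(t+s-r)S(r)Cx\,dr.$$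 2. For all $\varphi\in\mathcal D_{(-\tau,\tau)}$ and $x\in E$, $$\mathcal G(\varphi)x=(-1)^n\int_0^\tau\varphi^{(n)}(s)S(s)x\,ds.$$ 3. $(S(t))_{t\in[0,\tau)}$ is an $n$-times integrated $C$-existence family with subgenerator $\mathcal A$: for all $x\in E$ and $t\in[0,\tau)$, $$\Bigl(\int_0^tS(s)x\,ds,\ S(t)x-g_{n+1}(t)Cx\Bigr)\in\mathcal A .$$ 4. If $L(N)$ (with the topology of uniform convergence on bounded sets) is admissible, then there are $m\ge n-1$ and $T_0,\dots,T_m\in L(N)$ such that the restriction of $\mathcal G$ to $N$ is $\sum_{j=0}^m\delta^{(j)}\otimes T_j$, that is, $$\mathcal G(\varphi)x=\sum_{j=0}^m(-1)^j\varphi^{(j)}(0)T_jx,\qquad \varphi\in\mathcal D,\ x\in N;$$ and for every such $m\ge n-1$ and $T_0,\dots,T_m$ and every $x\in N$: $S(t)x=0$ for all $t\in[0,\tau)$ if and only if $T_ix=0$ for $0\le i\le n-1$. -/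

import Mathlib

open MeasureTheory Set Filter Topology

/-! ### Test functions on the real line -/

/-- The space of complex-valued smooth compactly supported functions on `ℝ`, with its usual
(inductive limit) topology. -/
abbrev TestFn : Type := TestFunction (⊤ : TopologicalSpace.Opens ℝ) ℂ (⊤ : ℕ∞)

/-- The derivative of a test function. -/
noncomputable def TestFn.derivative (φ : TestFn) : TestFn where
  toFun := deriv φ
  contDiff' := by
    have h : ContDiff ℝ ((⊤ : ℕ∞) : WithTop ℕ∞) φ := φ.contDiff
    exact (contDiff_infty_iff_deriv.1 h).2
  hasCompactSupport' := φ.hasCompactSupport.deriv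
  tsupport_subset' := fun _ _ => trivial

/-- Smoothness of `t ↦ ∫₀ᵗ f (t - s) g (s) ds`. -/
theorem contDiff_zeroConv {f g : ℝ → ℂ} (hf : ContDiff ℝ (⊤ : ℕ∞) f)
    (hg : ContDiff ℝ (⊤ : ℕ∞) g) :
    ContDiff ℝ (⊤ : ℕ∞) (fun t : ℝ => ∫ s in (0 : ℝ)..t, f (t - s) * g s) := by
  obtain ⟨χ, hχc, hχ0, hχ1⟩ : ∃ χ : ℝ → ℝ, ContDiff ℝ (⊤ : ℕ∞) χ ∧
      (∀ x, x ∉ Metric.closedBall (0 : ℝ) 3 → χ x = 0) ∧ ∀ y ∈ Icc (0 : ℝ) 1, χ (-y) = 1 := by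
    let χ : ContDiffBump (0 : ℝ) := ⟨1, 3, by norm_num, by norm_num⟩
    refine ⟨χ, χ.contDiff, fun x hx => χ.zero_of_le_dist ?_, fun y hy =>
      χ.one_of_mem_closedBall ?_⟩
    · simp only [Metric.mem_closedBall, not_le] at hx
      exact hx.le
    · simp only [Metric.mem_closedBall, dist_zero_right, norm_neg, Real.norm_eq_abs]
      rw [abs_of_nonneg hy.1]
      exact hy.2
  obtain ⟨k, hkdef⟩ : ∃ k : ℝ → ℝ → ℂ,
      k = fun t y => (χ y : ℂ) * (f (t * (1 + y)) * g (-(t * y))) := ⟨_, rfl⟩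
  obtain ⟨u, hudef⟩ : ∃ u : ℝ → ℝ, u = (Icc (0 : ℝ) 1).indicator (fun _ => (1 : ℝ)) := ⟨_, rfl⟩
  have hu : LocallyIntegrable u volume := by
    rw [hudef]
    exact ((integrable_indicator_iff measurableSet_Icc).2
      (integrableOn_const (by simp))).locallyIntegrable
  have hk : ContDiff ℝ (⊤ : ℕ∞) (fun p : ℝ × ℝ => k p.1 p.2) := by
    have h1 : ContDiff ℝ (⊤ : ℕ∞) (fun p : ℝ × ℝ => ((χ p.2 : ℝ) : ℂ)) :=
      Complex.ofRealCLM.contDiff.comp (hχc.comp contDiff_snd)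
    have h2 : ContDiff ℝ (⊤ : ℕ∞) (fun p : ℝ × ℝ => f (p.1 * (1 + p.2))) :=
      hf.comp (contDiff_fst.mul (contDiff_const.add contDiff_snd))
    have h3 : ContDiff ℝ (⊤ : ℕ∞) (fun p : ℝ × ℝ => g (-(p.1 * p.2))) :=
      hg.comp (contDiff_fst.mul contDiff_snd).neg
    rw [hkdef]
    exact h1.mul (h2.mul h3)
  have hsupp : ∀ p x : ℝ, p ∈ (univ : Set ℝ) → x ∉ Metric.closedBall (0 : ℝ) 3 → k p x = 0 := by
    intro p x _ hx
    simp [hkdef, hχ0 x hx]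
  have key := contDiffOn_convolution_right_with_param (𝕜 := ℝ) (μ := volume) (n := (⊤ : ℕ∞))
    (ContinuousLinearMap.lsmul ℝ ℝ : ℝ →L[ℝ] ℂ →L[ℝ] ℂ) (g := k) (f := u)
    isOpen_univ (isCompact_closedBall (0 : ℝ) 3) hsupp hu hk.contDiffOn
  rw [univ_prod_univ, contDiffOn_univ] at key
  have key1 : ContDiff ℝ (⊤ : ℕ∞) (fun t : ℝ =>
      (convolution u (k t) (ContinuousLinearMap.lsmul ℝ ℝ) volume) 0) :=
    key.comp (contDiff_id.prodMk contDiff_const : ContDiff ℝ (⊤ : ℕ∞) fun t : ℝ => (t, (0 : ℝ)))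
  have key2 : ContDiff ℝ (⊤ : ℕ∞) (fun t : ℝ => t •
      (convolution u (k t) (ContinuousLinearMap.lsmul ℝ ℝ) volume) 0) :=
    contDiff_id.smul key1
  convert key2 using 2 with t
  have e1 : (convolution u (k t) (ContinuousLinearMap.lsmul ℝ ℝ) volume) 0
      = ∫ y in (0 : ℝ)..1, f (t - y * t) * g (y * t) := by
    rw [intervalIntegral.integral_of_le zero_le_one, ← integral_Icc_eq_integral_Ioc,
      ← integral_indicator measurableSet_Icc, convolution]
    congr 1
    ext y
    by_cases hy : y ∈ Icc (0 : ℝ) 1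
    · simp only [hudef, hkdef, indicator_of_mem hy, zero_sub, hχ1 y hy,
        ContinuousLinearMap.lsmul_apply, one_smul, Complex.ofReal_one, one_mul]
      congr 2 <;> ring
    · simp [hudef, indicator_of_notMem hy]
  have e2 := intervalIntegral.smul_integral_comp_mul_right (a := (0 : ℝ)) (b := 1)
    (fun s : ℝ => f (t - s) * g s) t
  rw [zero_mul, one_mul] at e2
  rw [e1, ← e2]

theorem hasCompactSupport_zeroConv {f g : ℝ → ℂ} (hf : HasCompactSupport f)
    (hg : HasCompactSupport g) :
    HasCompactSupport (fun t : ℝ => ∫ s in (0 : ℝ)..t, f (t - s) * g s) := by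
  obtain ⟨a, ha⟩ := hf.isCompact.isBounded.subset_closedBall (0 : ℝ)
  obtain ⟨b, hb⟩ := hg.isCompact.isBounded.subset_closedBall (0 : ℝ)
  refine HasCompactSupport.intro (isCompact_closedBall (0 : ℝ) (a + b)) fun t ht => ?_
  have : ∀ s : ℝ, f (t - s) * g s = 0 := by
    intro s
    by_contra hne
    have h1 := ha (subset_tsupport f (left_ne_zero_of_mul hne))
    have h2 := hb (subset_tsupport g (right_ne_zero_of_mul hne))
    simp only [Metric.mem_closedBall, dist_zero_right, Real.norm_eq_abs] at h1 h2 ht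
    have := abs_add_le (t - s) s
    rw [sub_add_cancel] at this
    exact ht (by linarith)
  simp [this]

/-- The truncated convolution `(φ *₀ ψ)(t) = ∫₀ᵗ φ (t - s) ψ (s) ds` of two test functions. -/
noncomputable def TestFn.zeroConv (φ ψ : TestFn) : TestFn where
  toFun := fun t : ℝ => ∫ s in (0 : ℝ)..t, φ (t - s) * ψ s
  contDiff' := contDiff_zeroConv φ.contDiff ψ.contDiff
  hasCompactSupport' := hasCompactSupport_zeroConv φ.hasCompactSupport ψ.hasCompactSupport
  tsupport_subset' := fun _ _ => trivial

/-! ### Vector-valued integrals and distributions -/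

/-- `v` is the integral over the set `s ⊆ ℝ` (Lebesgue measure) of the function `f`, which takes
values in a locally convex space: every continuous linear functional is integrable along `f`, and
its integral is its value at `v`. -/
def HasSetIntegral {X : Type*} [AddCommGroup X] [Module ℂ X] [TopologicalSpace X]
    (s : Set ℝ) (f : ℝ → X) (v : X) : Prop :=
  ∀ l : X →L[ℂ] ℂ, IntegrableOn (fun t => l (f t)) s volume ∧ ∫ t in s, l (f t) = l v

/-- The `X`-valued distribution `F` is of finite order: on every interval `(-τ, τ)` it is the
`n`-th derivative, for some `n`, of a continuous function `f : [-τ, τ] → X`. -/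
def IsOfFiniteOrder {X : Type*} [AddCommGroup X] [Module ℂ X] [TopologicalSpace X]
    (F : TestFn →L[ℂ] X) : Prop :=
  ∀ τ : ℝ, 0 < τ → ∃ (n : ℕ) (f : ℝ → X), ContinuousOn f (Icc (-τ) τ) ∧
    ∀ φ : TestFn, tsupport φ ⊆ Ioo (-τ) τ →
      ∃ v : X, HasSetIntegral (Icc (-τ) τ) (fun t => iteratedDeriv n φ t • f t) v ∧
        F φ = (-1 : ℂ) ^ n • v

/-- The space `X` is admissible: every `X`-valued distribution supported in `{0}` is a finite sum
`∑ δ^(j) ⊗ x_j`, where `(δ^(j) ⊗ x)(φ) = (-1)^j φ^(j)(0) x`. -/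
def IsAdmissible (X : Type*) [AddCommGroup X] [Module ℂ X] [TopologicalSpace X] : Prop :=
  ∀ F : TestFn →L[ℂ] X, Distribution.IsVanishingOn F ({0}ᶜ : Set ℝ) →
    ∃ (m : ℕ) (x : ℕ → X), ∀ φ : TestFn,
      F φ = ∑ j ∈ Finset.range (m + 1), ((-1 : ℂ) ^ j * iteratedDeriv j φ 0) • x j

/-- Sequential completeness of a uniform space. -/
def IsSeqComplete (X : Type*) [UniformSpace X] : Prop :=
  ∀ u : ℕ → X, CauchySeq u → ∃ x : X, Tendsto u atTop (𝓝 x)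

/-! ### Degenerate `C`-distribution semigroups -/

section Semigroups

variable {E : Type*} [AddCommGroup E] [Module ℂ E] [TopologicalSpace E]
  [IsTopologicalAddGroup E] [ContinuousSMul ℂ E]

/-- `G` is a pre-(C-DS): an operator-valued distribution (operators carry the topology of uniform
convergence on bounded sets) supported in `[0, ∞)`, commuting with `C`, and satisfying
`G (φ *₀ ψ) C = G φ G ψ` for all test functions. -/
structure IsPreCDS (C : E →L[ℂ] E) (G : TestFn →L[ℂ] (E →L[ℂ] E)) : Prop where
  support_subset : Distribution.IsVanishingOn G ((Ici 0)ᶜ : Set ℝ)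
  comm : ∀ φ : TestFn, C ∘L G φ = G φ ∘L C
  zeroConv_comp : ∀ φ ψ : TestFn, G (φ.zeroConv ψ) ∘L C = G φ ∘L G ψ

/-- The kernel space `N(G)`: the intersection of the kernels of `G φ`, over all test functions `φ`
supported in `[0, ∞)`. -/
def kernelSpace (G : TestFn →L[ℂ] (E →L[ℂ] E)) : Submodule ℂ E where
  carrier := {x | ∀ φ : TestFn, tsupport φ ⊆ Ici 0 → G φ x = 0}
  add_mem' := fun hx hy φ hφ => by rw [map_add, hx φ hφ, hy φ hφ, add_zero]
  zero_mem' := fun φ _ => map_zero (G φ)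
  smul_mem' := fun c x hx φ hφ => by rw [map_smul, hx φ hφ, smul_zero]

/-- The generator `G(-δ')` of `G`, a multivalued linear operator in `E` (identified with its graph,
a linear subspace of `E × E`): all `(x, y)` with `G ((-δ') * φ) x = G φ y`, that is
`G (-φ') x = G φ y`, for every test function `φ` supported in `[0, ∞)`. -/
def generator (G : TestFn →L[ℂ] (E →L[ℂ] E)) : Submodule ℂ (E × E) where
  carrier := {p | ∀ φ : TestFn, tsupport φ ⊆ Ici 0 → G (-φ.derivative) p.1 = G φ p.2}
  add_mem' := fun {p q} hp hq φ hφ => by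
    rw [Prod.fst_add, Prod.snd_add, map_add, map_add, hp φ hφ, hq φ hφ]
  zero_mem' := fun φ _ => by rw [Prod.fst_zero, Prod.snd_zero, map_zero, map_zero]
  smul_mem' := fun c p hp φ hφ => by
    rw [Prod.smul_fst, Prod.smul_snd, map_smul, map_smul, hp φ hφ]

/-- The restriction of `G` to `N(G)` is `∑_{j ≤ m} δ^(j) ⊗ T_j`. -/
def IsDeltaExpansion (G : TestFn →L[ℂ] (E →L[ℂ] E)) (m : ℕ)
    (T : ℕ → (kernelSpace G →L[ℂ] kernelSpace G)) : Prop :=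
  ∀ (φ : TestFn) (x : kernelSpace G),
    G φ (x : E) =
      ∑ j ∈ Finset.range (m + 1), ((-1 : ℂ) ^ j * iteratedDeriv j φ 0) • (T j x : E)

/-! ### Integrated `C`-semigroups and existence families -/

/-- The function `g_α(t) = t^(α - 1) / Γ(α)`, as a complex number. -/
noncomputable def gFun (α t : ℝ) : ℂ := ((t ^ (α - 1) / Real.Gamma α : ℝ) : ℂ)

/-- The family `(S t)` with `t ∈ [0, τ)` is strongly continuous. -/
def IsStronglyContinuous (τ : ℝ) (S : ℝ → (E →L[ℂ] E)) : Prop :=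
  ∀ x : E, ContinuousOn (fun t => S t x) (Ico 0 τ)

/-- `(S t)`, `t ∈ [0, τ)`, is a local `α`-times integrated `C`-semigroup (`0 < α`, `0 < τ`). -/
structure IsIntegratedCSemigroup (C : E →L[ℂ] E) (α τ : ℝ) (S : ℝ → (E →L[ℂ] E)) : Prop where
  stronglyContinuous : IsStronglyContinuous τ S
  comm : ∀ t ∈ Ico 0 τ, S t ∘L C = C ∘L S t
  semigroup : ∀ x : E, ∀ t ∈ Ico 0 τ, ∀ s ∈ Ico 0 τ, t + s ∈ Ico 0 τ →
    ∃ a b c : E,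
      HasSetIntegral (Icc 0 (t + s)) (fun r => gFun α (t + s - r) • S r (C x)) a ∧
      HasSetIntegral (Icc 0 t) (fun r => gFun α (t + s - r) • S r (C x)) b ∧
      HasSetIntegral (Icc 0 s) (fun r => gFun α (t + s - r) • S r (C x)) c ∧
      S t (S s x) = a - b - c

/-- `(S t)`, `t ∈ [0, τ)`, is an `α`-times integrated `C`-existence family with subgenerator the
multivalued linear operator `A`: it is strongly continuous and, for all `x` and `t ∈ [0, τ)`,
`S t x - g_{α+1}(t) C x ∈ A (∫₀ᵗ S s x ds)`. -/
structure IsIntegratedCExistenceFamily (C : E →L[ℂ] E) (α τ : ℝ) (S : ℝ → (E →L[ℂ] E))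
    (A : Submodule ℂ (E × E)) : Prop where
  stronglyContinuous : IsStronglyContinuous τ S
  integral_mem : ∀ x : E, ∀ t ∈ Ico 0 τ, ∃ v : E,
    HasSetIntegral (Icc 0 t) (fun s => S s x) v ∧ (v, S t x - gFun (α + 1) t • C x) ∈ A

end Semigroups

/-! ### Parametric integrals and truncated convolutions of scalar functions -/

/-! All identities are tested against functionals `l`, so the work concerns scalar functions `l (S t
x)`.

Construction of `S`. Finite order writes `G` on `(-τ, τ)` as the `n`-th derivative of a continuous
`f`. Since `G` vanishes on the negative half-line, the lemma of du Bois-Reymond makes `f` weakly a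
polynomial of degree below `n` there. Lagrange interpolation at `n` negative nodes yields one
operator-valued polynomial `P` equal to `f` on `[-τ, 0]`. As `P` does not contribute to the `n`-th
derivative, `f - P` restricted to `[0, τ]` represents `G`
(`exists_isDerivativeOf_of_isOfFiniteOrder`). One more integration (`IsDerivativeOf.exists_succ`)
makes the order positive; there sequential completeness gives the integrals and barrelledness the
continuity of the integrated operators.

Identities for `S`. A continuous function on `[0, τ)` is determined by its integrals against `n`-th
derivatives of test functions (`eqOn_zero_of_integral_iteratedDeriv_mul`), so each relation for `G`
passes to `S` once both sides are written as such integrals. For `G (φ *₀ ψ) C = G φ G ψ` this is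
the scalar identity `integral_iteratedDeriv_truncConv_mul`; removing `ψ` and then `φ` gives the
semigroup law. For the existence family one uses `φ' *₀ ψ = φ *₀ ψ' + ψ(0) φ`, valid when `φ(0) =
0`.

Kernel space. `G` leaves `N` invariant, and its restriction is supported in `{0}`, so admissibility
provides the delta expansion. Test functions with prescribed derivatives at `0` then relate the `T
i` with `i < n` to the vanishing of `S`. -/

/-- Leibniz rule: the integral as a function of parameter and upper limit has continuous partial
derivatives, hence is differentiable, and is then restricted to the diagonal. -/
theorem hasDerivAt_intervalIntegral_param {F F' : ℝ → ℝ → ℂ} (hF : Continuous F.uncurry)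
    (hF' : Continuous F'.uncurry) (hd : ∀ t s, HasDerivAt (fun u => F u s) (F' t s) t) (t : ℝ) :
    HasDerivAt (fun u => ∫ s in (0 : ℝ)..u, F u s) (F t t + ∫ s in (0 : ℝ)..t, F' t s) t := by
  have h1 : ∀ v : ℝ × ℝ, HasDerivAt (fun u => ∫ s in (0 : ℝ)..v.2, F u s)
      (∫ s in (0 : ℝ)..v.2, F' v.1 s) v.1 := by
    rintro ⟨u, b⟩
    obtain ⟨M, hM⟩ := ((isCompact_closedBall u 1).prod (isCompact_uIcc (a := (0 : ℝ))
      (b := b))).exists_bound_of_continuousOn hF'.continuousOn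
    refine (intervalIntegral.hasDerivAt_integral_of_dominated_loc_of_deriv_le
      (bound := fun _ => M) (Metric.closedBall_mem_nhds u one_pos) (.of_forall fun x => ?_)
      ?_ ?_ ?_ ?_ ?_).2
    · exact (hF.comp (Continuous.prodMk_right x)).aestronglyMeasurable
    · exact (hF.comp (Continuous.prodMk_right u)).intervalIntegrable _ _
    · exact (hF'.comp (Continuous.prodMk_right u)).aestronglyMeasurable
    · exact .of_forall fun s hs x hx => hM (x, s) ⟨hx, uIoc_subset_uIcc hs⟩
    · exact intervalIntegrable_const
    · exact .of_forall fun s _ x _ => hd x s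
  have h2 : ∀ v : ℝ × ℝ, HasDerivAt (fun b => ∫ s in (0 : ℝ)..b, F v.1 s) (F v.1 v.2) v.2 :=
    fun v => (hF.comp (Continuous.prodMk_right v.1)).integral_hasStrictDerivAt 0 v.2 |>.hasDerivAt
  have c1 : Continuous fun v : ℝ × ℝ => ∫ s in (0 : ℝ)..v.2, F' v.1 s :=
    intervalIntegral.continuous_parametric_intervalIntegral_of_continuous
      (f := fun (v : ℝ × ℝ) s => F' v.1 s)
      (hF'.comp ((continuous_fst.comp continuous_fst).prodMk continuous_snd)) continuous_snd
  have key := hasStrictFDerivAt_uncurry_coprod (𝕜 := ℝ) (u := (t, t))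
    (f := fun u b => ∫ s in (0 : ℝ)..b, F u s)
    (f₁ := fun u b => ContinuousLinearMap.toSpanSingleton ℝ (∫ s in (0 : ℝ)..b, F' u s))
    (f₂ := fun u b => ContinuousLinearMap.toSpanSingleton ℝ (F u b))
    (.of_forall fun v => (h1 v).hasFDerivAt) (.of_forall fun v => (h2 v).hasFDerivAt)
    (((ContinuousLinearMap.toSpanSingletonCLE (𝕜 := ℝ) (E := ℂ)).continuous.comp c1).continuousAt)
    (((ContinuousLinearMap.toSpanSingletonCLE (𝕜 := ℝ) (E := ℂ)).continuous.comp hF).continuousAt)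
  have := HasFDerivAt.comp_hasDerivAt (f := fun u : ℝ => (u, u)) t key.hasFDerivAt
    ((hasDerivAt_id t).prodMk (hasDerivAt_id t))
  refine this.congr_deriv ?_
  simp [Function.HasUncurry.uncurry, add_comm]

theorem continuous_intervalIntegral_param {F : ℝ → ℝ → ℂ} (hF : Continuous F.uncurry)
    {a b : ℝ → ℝ} (ha : Continuous a) (hb : Continuous b) :
    Continuous fun u => ∫ s in a u..b u, F u s := by
  have : (fun u => ∫ s in a u..b u, F u s)
      = fun u => (∫ s in (0 : ℝ)..b u, F u s) - ∫ s in (0 : ℝ)..a u, F u s := by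
    ext u
    rw [intervalIntegral.integral_interval_sub_left] <;>
    exact (hF.comp (Continuous.prodMk_right u)).intervalIntegrable _ _
  rw [this]
  exact (intervalIntegral.continuous_parametric_intervalIntegral_of_continuous hF hb).sub
    (intervalIntegral.continuous_parametric_intervalIntegral_of_continuous hF ha)

/-- Both sides vanish at `T = 0` and have the same derivative in `T`, namely `∫₀ᵀ F T s ds`. -/
theorem integral_integral_triangle {F : ℝ → ℝ → ℂ} (hF : Continuous F.uncurry) (T : ℝ) :
    ∫ r in (0 : ℝ)..T, ∫ s in (0 : ℝ)..r, F r s = ∫ s in (0 : ℝ)..T, ∫ r in s..T, F r s := by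
  have hl : ∀ t, HasDerivAt (fun T => ∫ r in (0 : ℝ)..T, ∫ s in (0 : ℝ)..r, F r s)
      (∫ s in (0 : ℝ)..t, F t s) t := fun t =>
    ((continuous_intervalIntegral_param hF continuous_const
      continuous_id).integral_hasStrictDerivAt 0 t).hasDerivAt
  have hr : ∀ t, HasDerivAt (fun T => ∫ s in (0 : ℝ)..T, ∫ r in s..T, F r s)
      (∫ s in (0 : ℝ)..t, F t s) t := by
    intro t
    refine (hasDerivAt_intervalIntegral_param (F := fun T s => ∫ r in s..T, F r s)
      ?_ hF (fun T s => ?_) t).congr_deriv (by simp)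
    · have h1 : Continuous fun p : ℝ × ℝ => ∫ r in (0 : ℝ)..p.1, F r p.2 :=
        intervalIntegral.continuous_parametric_intervalIntegral_of_continuous
          (f := fun (p : ℝ × ℝ) r => F r p.2)
          (hF.comp (continuous_snd.prodMk (continuous_snd.comp continuous_fst))) continuous_fst
      have h2 : Continuous fun p : ℝ × ℝ => ∫ r in (0 : ℝ)..p.2, F r p.2 :=
        intervalIntegral.continuous_parametric_intervalIntegral_of_continuous
          (f := fun (p : ℝ × ℝ) r => F r p.2)
          (hF.comp (continuous_snd.prodMk (continuous_snd.comp continuous_fst))) continuous_snd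
      convert h1.sub h2 using 1
      ext p
      refine (intervalIntegral.integral_interval_sub_left ?_ ?_).symm <;>
      exact (hF.comp (Continuous.prodMk_left p.2)).intervalIntegrable _ _
    · exact ((hF.comp (Continuous.prodMk_left s)).integral_hasStrictDerivAt s T).hasDerivAt
  have hz : ∀ t, HasDerivAt (fun T => (∫ r in (0 : ℝ)..T, ∫ s in (0 : ℝ)..r, F r s)
      - ∫ s in (0 : ℝ)..T, ∫ r in s..T, F r s) 0 t := fun t =>
    ((hl t).sub (hr t)).congr_deriv (sub_self _)
  have := is_const_of_deriv_eq_zero (fun t => (hz t).differentiableAt) (fun t => (hz t).deriv) T 0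
  simpa [sub_eq_zero] using this

theorem ContDiff.iteratedDeriv_top {f : ℝ → ℂ} (hf : ContDiff ℝ (⊤ : ℕ∞) f) (n : ℕ) :
    ContDiff ℝ (⊤ : ℕ∞) (iteratedDeriv n f) := by
  induction n generalizing f with
  | zero => simpa using hf
  | succ n ih =>
    rw [iteratedDeriv_succ']
    exact ih (contDiff_infty_iff_deriv.1 hf).2

theorem ContDiff.hasDerivAt_iteratedDeriv {f : ℝ → ℂ} (hf : ContDiff ℝ (⊤ : ℕ∞) f) (n : ℕ)
    (t : ℝ) : HasDerivAt (iteratedDeriv n f) (iteratedDeriv (n + 1) f t) t := by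
  rw [iteratedDeriv_succ]
  exact ((contDiff_infty_iff_deriv.1 (hf.iteratedDeriv_top n)).1 t).hasDerivAt

theorem iteratedDeriv_eq_zero_of_le {f : ℝ → ℂ} (hf : ContDiff ℝ (⊤ : ℕ∞) f) {T : ℝ}
    (h : ∀ t, T ≤ t → f t = 0) (n : ℕ) : ∀ t, T ≤ t → iteratedDeriv n f t = 0 := by
  have h1 : ∀ t ∈ Ioi T, iteratedDeriv n f t = 0 := fun t ht => by
    have : f =ᶠ[𝓝 t] fun _ => 0 := by
      filter_upwards [Ioi_mem_nhds ht] with s hs using h s (le_of_lt hs)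
    rw [this.iteratedDeriv_eq n]
    simp
  have h2 : closure (Ioi T) ⊆ {t | iteratedDeriv n f t = 0} :=
    closure_minimal h1 (isClosed_eq (hf.iteratedDeriv_top n).continuous continuous_const)
  intro t ht
  exact h2 (by rwa [closure_Ioi])

/-- The truncated convolution `t ↦ ∫₀ᵗ f (t - s) h (s) ds`. -/
noncomputable def truncConv (f h : ℝ → ℂ) (t : ℝ) : ℂ := ∫ s in (0 : ℝ)..t, f (t - s) * h s

theorem truncConv_comm (f h : ℝ → ℂ) (t : ℝ) : truncConv f h t = truncConv h f t := by
  have := intervalIntegral.integral_comp_sub_left (a := 0) (b := t) (fun s => h (t - s) * f s) t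
  simp only [sub_sub_cancel, sub_self, sub_zero] at this
  simp only [truncConv, ← this]
  exact intervalIntegral.integral_congr fun s _ => mul_comm _ _

theorem continuous_truncConv {f h : ℝ → ℂ} (hf : Continuous f) (hh : Continuous h) :
    Continuous (truncConv f h) :=
  continuous_intervalIntegral_param (F := fun t s => f (t - s) * h s)
    ((hf.comp (continuous_fst.sub continuous_snd)).mul (hh.comp continuous_snd))
    continuous_const continuous_id

theorem hasDerivAt_truncConv {f h : ℝ → ℂ} (hf : ContDiff ℝ (⊤ : ℕ∞) f) (hh : Continuous h)
    (t : ℝ) : HasDerivAt (truncConv f h) (f 0 * h t + truncConv (deriv f) h t) t := by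
  have hd := contDiff_infty_iff_deriv.1 hf
  refine (hasDerivAt_intervalIntegral_param (F := fun t s => f (t - s) * h s)
    (F' := fun t s => deriv f (t - s) * h s)
    ((hf.continuous.comp (continuous_fst.sub continuous_snd)).mul (hh.comp continuous_snd))
    ((hd.2.continuous.comp (continuous_fst.sub continuous_snd)).mul (hh.comp continuous_snd))
    (fun t s => ?_) t).congr_deriv (by simp [truncConv])
  exact ((hd.1 (t - s)).hasDerivAt.comp_sub_const t s).mul_const (h s)

/-- Each derivative falls on `f`; differentiating the upper limit leaves a boundary term carrying a
derivative of `f` at `0`. -/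
theorem iteratedDeriv_truncConv {f h : ℝ → ℂ} (hf : ContDiff ℝ (⊤ : ℕ∞) f)
    (hh : ContDiff ℝ (⊤ : ℕ∞) h) (n : ℕ) (t : ℝ) :
    iteratedDeriv n (truncConv f h) t = truncConv (iteratedDeriv n f) h t
      + ∑ j ∈ Finset.range n, iteratedDeriv j f 0 * iteratedDeriv (n - 1 - j) h t := by
  induction n generalizing f t with
  | zero => simp
  | succ n ih =>
    have hd := (contDiff_infty_iff_deriv.1 hf).2
    have e : deriv (truncConv f h) = fun t => f 0 * h t + truncConv (deriv f) h t := by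
      ext t
      exact (hasDerivAt_truncConv hf hh.continuous t).deriv
    have hs : ContDiff ℝ (⊤ : ℕ∞) (truncConv (deriv f) h) := contDiff_zeroConv hd hh
    have hc : ContDiffAt ℝ (n : WithTop ℕ∞) h t :=
      (hh.of_le (by exact_mod_cast le_top)).contDiffAt
    have hc' : ContDiffAt ℝ (n : WithTop ℕ∞) (truncConv (deriv f) h) t :=
      (hs.of_le (by exact_mod_cast le_top)).contDiffAt
    rw [iteratedDeriv_succ', e, iteratedDeriv_fun_add (contDiffAt_const.mul hc) hc',
      iteratedDeriv_const_mul_field, ih hd, Finset.sum_range_succ', iteratedDeriv_succ']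
    have : ∀ j, n + 1 - 1 - (j + 1) = n - 1 - j := fun j => by omega
    simp only [this, iteratedDeriv_zero, ← iteratedDeriv_succ']
    simp
    ring

theorem Continuous.intervalIntegral_add {f g : ℝ → ℂ} (hf : Continuous f) (hg : Continuous g)
    (a b : ℝ) : ∫ s in a..b, (f s + g s) = (∫ s in a..b, f s) + ∫ s in a..b, g s :=
  intervalIntegral.integral_add (hf.intervalIntegrable _ _) (hg.intervalIntegrable _ _)

theorem integral_iteratedDeriv_succ_mul {φ u u' : ℝ → ℂ} (hφ : ContDiff ℝ (⊤ : ℕ∞) φ) {T : ℝ}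
    (hT : ∀ t, T ≤ t → φ t = 0) (hu : ∀ t, HasDerivAt u (u' t) t) (hu' : Continuous u') (n : ℕ) :
    ∫ s in (0 : ℝ)..T, iteratedDeriv (n + 1) φ s * u s
      = - (iteratedDeriv n φ 0 * u 0) - ∫ s in (0 : ℝ)..T, iteratedDeriv n φ s * u' s := by
  have := intervalIntegral.integral_deriv_mul_eq_sub (a := 0) (b := T)
    (u := iteratedDeriv n φ) (v := u) (u' := iteratedDeriv (n + 1) φ) (v' := u')
    (fun x _ => hφ.hasDerivAt_iteratedDeriv n x) (fun x _ => hu x)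
    ((hφ.iteratedDeriv_top _).continuous.intervalIntegrable _ _) (hu'.intervalIntegrable _ _)
  have hc : Continuous u := continuous_iff_continuousAt.2 fun t => (hu t).continuousAt
  rw [Continuous.intervalIntegral_add ((hφ.iteratedDeriv_top _).continuous.fun_mul hc)
    ((hφ.iteratedDeriv_top _).continuous.fun_mul hu'),
    iteratedDeriv_eq_zero_of_le hφ hT n T le_rfl] at this
  linear_combination this

/-- Repeated integration by parts. The endpoint terms vanish, since `φ` is zero at `T` and a
truncated convolution is zero at `0`; the sum comes only from differentiating the upper limit of the
convolution. -/
theorem integral_iteratedDeriv_mul_truncConv {φ f h : ℝ → ℂ} (hφ : ContDiff ℝ (⊤ : ℕ∞) φ) {T : ℝ}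
    (hT : ∀ t, T ≤ t → φ t = 0) (hf : ContDiff ℝ (⊤ : ℕ∞) f) (hh : Continuous h) (n : ℕ) :
    ∫ s in (0 : ℝ)..T, iteratedDeriv n φ s * truncConv f h s
      = (∑ j ∈ Finset.range n, (-1) ^ (j + 1) * iteratedDeriv j f 0
          * ∫ s in (0 : ℝ)..T, iteratedDeriv (n - 1 - j) φ s * h s)
        + (-1) ^ n * ∫ s in (0 : ℝ)..T, φ s * truncConv (iteratedDeriv n f) h s := by
  induction n generalizing f with
  | zero => simp
  | succ n ih =>
    have hd := (contDiff_infty_iff_deriv.1 hf).2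
    have hcd := continuous_truncConv hd.continuous hh
    rw [integral_iteratedDeriv_succ_mul hφ hT (hasDerivAt_truncConv hf hh)
      ((continuous_const.mul hh).add hcd) n]
    have e : ∀ s, iteratedDeriv n φ s * (f 0 * h s + truncConv (deriv f) h s)
        = f 0 * (iteratedDeriv n φ s * h s) + iteratedDeriv n φ s * truncConv (deriv f) h s :=
      fun s => by ring
    have hc := (hφ.iteratedDeriv_top n).continuous
    simp only [e]
    rw [Continuous.intervalIntegral_add (continuous_const.fun_mul (hc.fun_mul hh))
      (hc.fun_mul hcd), ih hd, Finset.sum_range_succ',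
      intervalIntegral.integral_const_mul]
    have : ∀ j, n + 1 - 1 - (j + 1) = n - 1 - j := fun j => by omega
    simp only [this, iteratedDeriv_zero, ← iteratedDeriv_succ']
    have e2 : ∀ j, (-1 : ℂ) ^ (j + 1 + 1) = - (-1) ^ (j + 1) := fun j => by ring
    simp only [e2, neg_mul, Finset.sum_neg_distrib]
    simp [truncConv]
    ring

/-! ### Normalized monomials -/

/-- The monomial `t ^ k / k!`. -/
noncomputable def dividedPow (k : ℕ) (t : ℝ) : ℂ := (t : ℂ) ^ k / (k.factorial : ℂ)

theorem contDiff_dividedPow (k : ℕ) : ContDiff ℝ (⊤ : ℕ∞) (dividedPow k) := by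
  unfold dividedPow
  exact (Complex.ofRealCLM.contDiff.pow k).div_const _

theorem hasDerivAt_dividedPow_succ (k : ℕ) (t : ℝ) :
    HasDerivAt (dividedPow (k + 1)) (dividedPow k t) t := by
  have h := ((Complex.ofRealCLM.hasDerivAt (x := t)).fun_pow (k + 1)).div_const
    ((k + 1).factorial : ℂ)
  refine h.congr_deriv ?_
  have h1 : (k.factorial : ℂ) ≠ 0 := by exact_mod_cast k.factorial_ne_zero
  have h2 : (k + 1 : ℂ) ≠ 0 := by exact_mod_cast k.succ_ne_zero
  simp only [dividedPow, Nat.factorial_succ]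
  push_cast
  simp
  field_simp

theorem dividedPow_zero_left (t : ℝ) : dividedPow 0 t = 1 := by simp [dividedPow]

theorem dividedPow_succ_zero (k : ℕ) : dividedPow (k + 1) 0 = 0 := by simp [dividedPow]

theorem iteratedDeriv_dividedPow (k j : ℕ) :
    iteratedDeriv j (dividedPow (k + j)) = dividedPow k := by
  induction j with
  | zero => simp
  | succ j ih =>
    rw [iteratedDeriv_succ', ← add_assoc,
      funext fun t => (hasDerivAt_dividedPow_succ (k + j) t).deriv, ih]

theorem iteratedDeriv_dividedPow_of_lt {k j : ℕ} (h : k < j) :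
    iteratedDeriv j (dividedPow k) = 0 := by
  obtain ⟨i, rfl⟩ := Nat.exists_eq_add_of_lt h
  have h0 : iteratedDeriv k (dividedPow k) = dividedPow 0 := by
    simpa using iteratedDeriv_dividedPow 0 k
  have h1 : deriv (dividedPow 0) = fun _ => 0 := by
    ext t
    rw [funext dividedPow_zero_left]
    simp
  rw [show k + i + 1 = i + 1 + k by omega]
  clear h
  have : ∀ i, iteratedDeriv (i + k) (dividedPow k) = iteratedDeriv i (dividedPow 0) := by
    intro i
    rw [iteratedDeriv_eq_iterate, Function.iterate_add_apply, ← iteratedDeriv_eq_iterate,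
      ← iteratedDeriv_eq_iterate, h0]
  rw [this, iteratedDeriv_succ', h1]
  ext
  simp

/-- On the half-line, `δ` is the derivative of order `k + 1` of `t ^ k / k!`. This turns boundary
values at `0` into integrals against a high derivative. -/
theorem eq_integral_iteratedDeriv_mul_dividedPow {φ : ℝ → ℂ} (hφ : ContDiff ℝ (⊤ : ℕ∞) φ) {T : ℝ}
    (hT : ∀ t, T ≤ t → φ t = 0) (k : ℕ) :
    φ 0 = (-1) ^ (k + 1) * ∫ s in (0 : ℝ)..T, iteratedDeriv (k + 1) φ s * dividedPow k s := by
  induction k with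
  | zero =>
    have := intervalIntegral.integral_eq_sub_of_hasDerivAt (a := 0) (b := T)
      (fun x _ => hφ.hasDerivAt_iteratedDeriv 0 x)
      ((hφ.iteratedDeriv_top _).continuous.intervalIntegrable _ _)
    simp only [dividedPow_zero_left, mul_one]
    rw [this]
    simp [hT T le_rfl]
  | succ k ih =>
    rw [integral_iteratedDeriv_succ_mul hφ hT (hasDerivAt_dividedPow_succ k)
      (contDiff_dividedPow k).continuous, dividedPow_succ_zero, ih]
    ring

theorem intervalIntegral_eq_of_eq_zero_of_le {f : ℝ → ℂ} (hf : Continuous f) {a T : ℝ}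
    (h : ∀ t, a ≤ t → f t = 0) (haT : a ≤ T) :
    ∫ s in (0 : ℝ)..T, f s = ∫ s in (0 : ℝ)..a, f s := by
  rw [← intervalIntegral.integral_add_adjacent_intervals (hf.intervalIntegrable 0 a)
    (hf.intervalIntegrable a T), add_eq_left]
  rw [intervalIntegral.integral_congr (g := fun _ => 0)]
  · simp
  · intro s hs
    rw [uIcc_of_le haT] at hs
    exact h s hs.1

theorem truncConv_zero_left (h : ℝ → ℂ) : truncConv 0 h = 0 := by
  ext t
  simp [truncConv]

/-! ### The kernel of the semigroup law -/

/-- The kernel `u ↦ (∫₀^(u+s) - ∫₀ˢ - ∫₀ᵘ) (u + s - r)ᵏ / k! h(r) dr`. -/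
noncomputable def semigroupKernel (k : ℕ) (h : ℝ → ℂ) (s u : ℝ) : ℂ :=
  truncConv (dividedPow k) (fun r => h (r + s)) u - truncConv (fun v => dividedPow k (v + s)) h u

theorem continuous_semigroupKernel (k : ℕ) {h : ℝ → ℂ} (hh : Continuous h) :
    Continuous fun p : ℝ × ℝ => semigroupKernel k h p.1 p.2 := by
  have hp := (contDiff_dividedPow k).continuous
  refine (intervalIntegral.continuous_parametric_intervalIntegral_of_continuous
    (f := fun (p : ℝ × ℝ) r => dividedPow k (p.2 - r) * h (r + p.1)) ?_ continuous_snd).sub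
    (intervalIntegral.continuous_parametric_intervalIntegral_of_continuous
    (f := fun (p : ℝ × ℝ) r => dividedPow k (p.2 - r + p.1) * h r) ?_ continuous_snd)
  · exact (hp.comp (by fun_prop : Continuous fun q : (ℝ × ℝ) × ℝ => q.1.2 - q.2)).mul
      (hh.comp (by fun_prop : Continuous fun q : (ℝ × ℝ) × ℝ => q.2 + q.1.1))
  · exact (hp.comp (by fun_prop : Continuous fun q : (ℝ × ℝ) × ℝ => q.1.2 - q.2 + q.1.1)).mul
      (hh.comp (by fun_prop : Continuous fun q : (ℝ × ℝ) × ℝ => q.2))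

theorem semigroupKernel_eq (k : ℕ) {h : ℝ → ℂ} (hh : Continuous h) (s u : ℝ) :
    semigroupKernel k h s u = (∫ r in (0 : ℝ)..(u + s), dividedPow k (u + s - r) * h r)
      - (∫ r in (0 : ℝ)..u, dividedPow k (u + s - r) * h r)
      - ∫ r in (0 : ℝ)..s, dividedPow k (u + s - r) * h r := by
  have hc : Continuous fun r => dividedPow k (u + s - r) * h r :=
    ((contDiff_dividedPow k).continuous.comp (by fun_prop)).mul hh
  have h1 := intervalIntegral.integral_comp_add_right (a := 0) (b := u)
    (fun r => dividedPow k (u + s - r) * h r) s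
  have h2 := intervalIntegral.integral_add_adjacent_intervals (hc.intervalIntegrable 0 s)
    (hc.intervalIntegrable s (u + s)) (μ := volume)
  rw [zero_add] at h1
  have e1 : truncConv (dividedPow k) (fun r => h (r + s)) u
      = ∫ r in s..(u + s), dividedPow k (u + s - r) * h r := by
    rw [← h1]
    refine intervalIntegral.integral_congr fun r _ => ?_
    simp only
    congr 2
    ring
  have e2 : truncConv (fun v => dividedPow k (v + s)) h u
      = ∫ r in (0 : ℝ)..u, dividedPow k (u + s - r) * h r := by
    refine intervalIntegral.integral_congr fun r _ => ?_
    simp only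
    congr 2
    ring
  rw [semigroupKernel, e1, e2, ← h2]
  ring

/-- Both convolutions in the kernel have a polynomial factor of degree `k`, annihilated by `k + 1`
derivatives, so only boundary terms remain. For the unshifted monomial just `j = k` survives and
gives the translate of `h`; the shifted one gives the sum. -/
theorem integral_iteratedDeriv_mul_semigroupKernel {φ h : ℝ → ℂ} (hφ : ContDiff ℝ (⊤ : ℕ∞) φ)
    {a : ℝ} (ha : ∀ t, a ≤ t → φ t = 0) (hh : Continuous h) (k : ℕ) (s : ℝ) :
    ∫ u in (0 : ℝ)..a, iteratedDeriv (k + 1) φ u * semigroupKernel k h s u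
      = (-1) ^ (k + 1) * (∫ u in (0 : ℝ)..a, φ u * h (u + s))
        + ∑ j ∈ Finset.range (k + 1), (-1) ^ j * dividedPow (k - j) s
          * ∫ u in (0 : ℝ)..a, iteratedDeriv (k - j) φ u * h u := by
  have hp := contDiff_dividedPow k
  have hps : ContDiff ℝ (⊤ : ℕ∞) fun v => dividedPow k (v + s) :=
    hp.comp (contDiff_id.add contDiff_const)
  have hhs : Continuous fun r => h (r + s) := by fun_prop
  have c1 := continuous_truncConv hp.continuous hhs
  have c2 := continuous_truncConv hps.continuous hh
  have cφ := (hφ.iteratedDeriv_top (k + 1)).continuous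
  simp only [semigroupKernel, mul_sub]
  rw [intervalIntegral.integral_sub ((cφ.fun_mul c1).intervalIntegrable _ _)
    ((cφ.fun_mul c2).intervalIntegrable _ _),
    integral_iteratedDeriv_mul_truncConv hφ ha hp hhs,
    integral_iteratedDeriv_mul_truncConv hφ ha hps hh]
  have z : ∀ j, iteratedDeriv j (fun v => dividedPow k (v + s))
      = fun v => iteratedDeriv j (dividedPow k) (v + s) := fun j => by
    rw [iteratedDeriv_comp_add_const]
  have z1 : iteratedDeriv (k + 1) (dividedPow k) = 0 := iteratedDeriv_dividedPow_of_lt k.lt_succ_self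
  have z2 : iteratedDeriv (k + 1) (fun v => dividedPow k (v + s)) = 0 := by
    rw [z, z1]; rfl
  have d : ∀ j ≤ k, iteratedDeriv j (dividedPow k) = dividedPow (k - j) := fun j hj => by
    have := iteratedDeriv_dividedPow (k - j) j
    rwa [Nat.sub_add_cancel hj] at this
  rw [z1, z2, truncConv_zero_left, truncConv_zero_left]
  simp only [Pi.zero_apply, mul_zero, intervalIntegral.integral_zero, add_zero]
  rw [sub_eq_add_neg, ← Finset.sum_neg_distrib]
  congr 1
  · rw [Finset.sum_range_succ, Finset.sum_eq_zero, zero_add, d k le_rfl, Nat.sub_self,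
      dividedPow_zero_left]
    · simp
    · intro j hj
      rw [Finset.mem_range] at hj
      obtain ⟨i, hi⟩ := Nat.exists_eq_add_of_lt hj
      rw [d j hj.le, show k - j = i + 1 by omega, dividedPow_succ_zero]
      ring
  · refine Finset.sum_congr rfl fun j hj => ?_
    rw [Finset.mem_range] at hj
    rw [z, d j (by omega)]
    simp only [zero_add]
    rw [show k + 1 - 1 - j = k - j by omega]
    ring

/-- Exchange the integrals over the triangle and substitute `r = u + s`; `a + b ≤ τ` keeps the whole
support inside the range of integration. -/
theorem integral_truncConv_mul {φ β h : ℝ → ℂ} (hφ : Continuous φ) (hβ : Continuous β)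
    (hh : Continuous h) {a b τ : ℝ} (ha : ∀ t, a ≤ t → φ t = 0) (hb : ∀ t, b ≤ t → β t = 0)
    (hb0 : 0 ≤ b) (ha0 : 0 ≤ a) (hτ : a + b ≤ τ) :
    ∫ r in (0 : ℝ)..τ, truncConv β φ r * h r
      = ∫ s in (0 : ℝ)..b, β s * ∫ u in (0 : ℝ)..a, φ u * h (u + s) := by
  have e1 : ∀ r, truncConv β φ r * h r = ∫ s in (0 : ℝ)..r, φ (r - s) * β s * h r := fun r => by
    rw [truncConv_comm, truncConv, intervalIntegral.integral_mul_const]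
  have hc : Continuous (Function.uncurry fun r s => φ (r - s) * β s * h r) :=
    ((hφ.comp (by fun_prop : Continuous fun p : ℝ × ℝ => p.1 - p.2)).mul
      (hβ.comp continuous_snd)).mul (hh.comp continuous_fst)
  have hin : Continuous fun s => ∫ u in (0 : ℝ)..a, φ u * h (u + s) :=
    continuous_intervalIntegral_param (F := fun s u => φ u * h (u + s))
      ((hφ.comp continuous_snd).mul
        (hh.comp (by fun_prop : Continuous fun p : ℝ × ℝ => p.2 + p.1)))
      continuous_const continuous_const
  simp only [e1]
  rw [integral_integral_triangle hc,
    ← intervalIntegral_eq_of_eq_zero_of_le (T := τ) (hβ.fun_mul hin)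
      (fun t ht => by simp [hb t ht]) (by linarith)]
  refine intervalIntegral.integral_congr fun s hs => ?_
  rw [uIcc_of_le (by linarith [hb0])] at hs
  by_cases hsb : b ≤ s
  · simp [hb s hsb]
  · have := intervalIntegral.integral_comp_add_right (a := 0) (b := τ - s)
      (fun r => φ (r - s) * β s * h r) s
    rw [zero_add, sub_add_cancel] at this
    rw [← this, ← intervalIntegral_eq_of_eq_zero_of_le (T := τ - s)
      (hφ.fun_mul (by fun_prop : Continuous fun u => h (u + s))) (fun t ht => by simp [ha t ht])
      (by linarith), ← intervalIntegral.integral_const_mul]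
    refine intervalIntegral.integral_congr fun u _ => ?_
    simp only [add_sub_cancel_right]
    ring

/-- The scalar form of the semigroup law. With all derivatives on `ψ`, the convolution term matches
the translate term of the kernel formula, and the boundary values of `ψ` at `0`, rewritten as
integrals, match its sum. -/
theorem integral_iteratedDeriv_truncConv_mul {φ ψ h : ℝ → ℂ} (hφ : ContDiff ℝ (⊤ : ℕ∞) φ)
    (hψ : ContDiff ℝ (⊤ : ℕ∞) ψ) (hh : Continuous h) {a b τ : ℝ}
    (ha : ∀ t, a ≤ t → φ t = 0) (hb : ∀ t, b ≤ t → ψ t = 0)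
    (ha0 : 0 ≤ a) (hb0 : 0 ≤ b) (hτ : a + b ≤ τ) (k : ℕ) :
    (-1) ^ (k + 1) * ∫ r in (0 : ℝ)..τ, iteratedDeriv (k + 1) (truncConv φ ψ) r * h r
      = ∫ s in (0 : ℝ)..b, iteratedDeriv (k + 1) ψ s
          * ∫ u in (0 : ℝ)..a, iteratedDeriv (k + 1) φ u * semigroupKernel k h s u := by
  have cψ := (hψ.iteratedDeriv_top (k + 1)).continuous
  have cφ := fun j => (hφ.iteratedDeriv_top j).continuous
  have hc : Continuous fun s => ∫ u in (0 : ℝ)..a, φ u * h (u + s) :=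
    continuous_intervalIntegral_param (F := fun s u => φ u * h (u + s))
      ((hφ.continuous.comp continuous_snd).mul
        (hh.comp (by fun_prop : Continuous fun p : ℝ × ℝ => p.2 + p.1)))
      continuous_const continuous_const
  have hm : ∀ j ∈ Finset.range (k + 1), iteratedDeriv j ψ 0 = (-1) ^ (k - j + 1) *
      ∫ s in (0 : ℝ)..b, iteratedDeriv (k + 1) ψ s * dividedPow (k - j) s := by
    intro j hj
    rw [eq_integral_iteratedDeriv_mul_dividedPow (hψ.iteratedDeriv_top j)
      (iteratedDeriv_eq_zero_of_le hψ hb j) (k - j)]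
    have : iteratedDeriv (k - j + 1) (iteratedDeriv j ψ) = iteratedDeriv (k + 1) ψ := by
      rw [iteratedDeriv_eq_iterate, iteratedDeriv_eq_iterate, iteratedDeriv_eq_iterate,
        ← Function.iterate_add_apply]
      rw [Finset.mem_range] at hj
      rw [show k - j + 1 + j = k + 1 by omega]
    rw [this]
  have e : ∀ r, iteratedDeriv (k + 1) (truncConv φ ψ) r * h r
      = truncConv (iteratedDeriv (k + 1) ψ) φ r * h r
        + ∑ j ∈ Finset.range (k + 1), iteratedDeriv j ψ 0 * (iteratedDeriv (k - j) φ r * h r) := by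
    intro r
    rw [funext (truncConv_comm φ ψ), iteratedDeriv_truncConv hψ hφ, add_mul, Finset.sum_mul]
    simp [mul_assoc]
  simp only [e]
  rw [Continuous.intervalIntegral_add
      ((continuous_truncConv cψ hφ.continuous).fun_mul hh)
      (continuous_finsetSum _ fun j _ => continuous_const.fun_mul ((cφ _).fun_mul hh)),
    intervalIntegral.integral_finsetSum
      (fun j _ => (continuous_const.fun_mul ((cφ _).fun_mul hh)).intervalIntegrable _ _),
    integral_truncConv_mul hφ.continuous cψ hh ha (iteratedDeriv_eq_zero_of_le hψ hb _) hb0 ha0 hτ]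
  simp only [integral_iteratedDeriv_mul_semigroupKernel hφ ha hh, mul_add, Finset.mul_sum]
  rw [Continuous.intervalIntegral_add
      (cψ.fun_mul (continuous_const.fun_mul hc))
      (continuous_finsetSum _ fun j _ => cψ.fun_mul ((continuous_const.fun_mul
        (contDiff_dividedPow _).continuous).fun_mul continuous_const)),
    intervalIntegral.integral_finsetSum
      (fun j _ => (cψ.fun_mul ((continuous_const.fun_mul
        (contDiff_dividedPow _).continuous).fun_mul continuous_const)).intervalIntegrable _ _)]
  congr 1
  · rw [← intervalIntegral.integral_const_mul]
    exact intervalIntegral.integral_congr fun s _ => by ring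
  · refine Finset.sum_congr rfl fun j hj => ?_
    rw [hm j hj, intervalIntegral.integral_const_mul,
      intervalIntegral_eq_of_eq_zero_of_le ((cφ _).fun_mul hh) (T := τ) (a := a)
        (fun t ht => by simp [iteratedDeriv_eq_zero_of_le hφ ha _ t ht]) (by linarith)]
    rw [Finset.mem_range] at hj
    have sgn : (-1 : ℂ) ^ (k + 1) * (-1) ^ (k - j + 1) = (-1) ^ j := by
      obtain ⟨i, rfl⟩ := Nat.exists_eq_add_of_le (Nat.lt_succ_iff.1 hj)
      rw [Nat.add_sub_cancel_left, ← pow_add]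
      rw [show j + i + 1 + (i + 1) = j + 2 * (i + 1) by ring, pow_add, pow_mul]
      simp
    have : ∀ s, iteratedDeriv (k + 1) ψ s * ((-1) ^ j * dividedPow (k - j) s *
        ∫ u in (0 : ℝ)..a, iteratedDeriv (k - j) φ u * h u)
        = ((-1) ^ j * ∫ u in (0 : ℝ)..a, iteratedDeriv (k - j) φ u * h u)
          * (iteratedDeriv (k + 1) ψ s * dividedPow (k - j) s) := fun s => by ring
    rw [intervalIntegral.integral_congr fun s _ => this s, intervalIntegral.integral_const_mul,
      ← sgn]
    ring

/-! ### Construction of test functions -/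

/-- The test function given by a smooth compactly supported function. -/
noncomputable def TestFn.of (f : ℝ → ℂ) (hf : ContDiff ℝ (⊤ : ℕ∞) f) (hc : HasCompactSupport f) :
    TestFn where
  toFun := f
  contDiff' := hf
  hasCompactSupport' := hc
  tsupport_subset' := fun _ _ => trivial

@[simp]
theorem TestFn.coe_of (f : ℝ → ℂ) (hf : ContDiff ℝ (⊤ : ℕ∞) f) (hc : HasCompactSupport f) :
    ⇑(TestFn.of f hf hc) = f := rfl

@[simp]
theorem TestFn.coe_derivative (φ : TestFn) : ⇑φ.derivative = deriv φ := rfl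

@[simp]
theorem TestFn.coe_zeroConv (φ ψ : TestFn) : ⇑(φ.zeroConv ψ) = truncConv φ ψ := rfl

theorem TestFn.smooth (φ : TestFn) : ContDiff ℝ (⊤ : ℕ∞) φ := φ.contDiff

theorem TestFn.exists_coe_eq {f : ℝ → ℂ} (hf : ContDiff ℝ (⊤ : ℕ∞) f) (hc : HasCompactSupport f) :
    ∃ φ : TestFn, ⇑φ = f :=
  ⟨TestFn.of f hf hc, rfl⟩

theorem TestFn.integrable (φ : TestFn) : Integrable φ :=
  φ.smooth.continuous.integrable_of_hasCompactSupport φ.hasCompactSupport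

theorem TestFn.of_eqOn_compl_Icc {f : ℝ → ℂ} (hf : ContDiff ℝ (⊤ : ℕ∞) f) {a b : ℝ}
    (h : ∀ t, t ∉ Icc a b → f t = 0) :
    ∃ φ : TestFn, ⇑φ = f ∧ tsupport φ ⊆ Icc a b := by
  refine ⟨TestFn.of f hf (HasCompactSupport.intro isCompact_Icc h), rfl, ?_⟩
  refine closure_minimal (fun t ht => ?_) isClosed_Icc
  by_contra hn
  exact ht (h t hn)

theorem TestFn.exists_Icc {φ : TestFn} {a b : ℝ} (hab : a < b) (h : tsupport φ ⊆ Ioo a b) :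
    ∃ c d, a < c ∧ c < d ∧ d < b ∧ tsupport φ ⊆ Icc c d := by
  rcases (tsupport φ).eq_empty_or_nonempty with he | hne
  · refine ⟨a + (b - a) / 3, a + 2 * (b - a) / 3, by linarith, by linarith, by linarith, ?_⟩
    simp [he]
  · have hk : IsCompact (tsupport φ) := φ.hasCompactSupport
    have h1 := h (hk.sInf_mem hne)
    have h2 := h (hk.sSup_mem hne)
    have h3 : sInf (tsupport φ) ≤ sSup (tsupport φ) :=
      csInf_le_csSup hne hk.bddBelow hk.bddAbove
    refine ⟨(a + sInf (tsupport φ)) / 2, (b + sSup (tsupport φ)) / 2, by linarith [h1.1],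
      by linarith [h1.1, h2.2], by linarith [h2.2], fun t ht => ?_⟩
    have h4 := csInf_le hk.bddBelow ht
    have h5 := le_csSup hk.bddAbove ht
    exact ⟨by linarith [h1.1], by linarith [h2.2]⟩

theorem eq_zero_of_tsupport_subset {φ : ℝ → ℂ} {s : Set ℝ} (h : tsupport φ ⊆ s) {t : ℝ}
    (ht : t ∉ s) : φ t = 0 :=
  image_eq_zero_of_notMem_tsupport fun hm => ht (h hm)

theorem exists_smooth_step {a b : ℝ} (hab : a < b) :
    ∃ χ : ℝ → ℂ, ContDiff ℝ (⊤ : ℕ∞) χ ∧ (∀ t ≤ a, χ t = 0) ∧ ∀ t, b ≤ t → χ t = 1 := by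
  refine ⟨fun t => (Real.smoothTransition ((t - a) / (b - a)) : ℂ), ?_, fun t ht => ?_,
    fun t ht => ?_⟩
  · exact Complex.ofRealCLM.contDiff.comp (Real.smoothTransition.contDiff.comp
      ((contDiff_id.sub contDiff_const).div_const _))
  · simp only
    rw [Real.smoothTransition.zero_of_nonpos]
    · simp
    · exact div_nonpos_of_nonpos_of_nonneg (by linarith) (by linarith)
  · simp only
    rw [Real.smoothTransition.one_of_one_le]
    · simp
    · rw [le_div_iff₀ (by linarith)]
      linarith

theorem TestFn.exists_cutoff (φ : TestFn) {a b : ℝ} (hab : a < b) :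
    ∃ ψ : TestFn, (∀ t ≤ a, ψ t = 0) ∧ (∀ t, b ≤ t → ψ t = φ t) ∧
      tsupport ψ ⊆ tsupport φ := by
  obtain ⟨χ, hχ, h0, h1⟩ := exists_smooth_step hab
  have hsupp : Function.support (fun t => φ t * χ t) ⊆ Function.support φ := fun t ht h =>
    ht (by simp [h])
  refine ⟨TestFn.of (fun t => φ t * χ t) (φ.smooth.mul hχ) φ.hasCompactSupport.mul_right,
    fun t ht => ?_, fun t ht => ?_, ?_⟩
  · simp [h0 t ht]
  · simp [h1 t ht]
  · exact closure_mono hsupp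

theorem contDiff_primitive {β : ℝ → ℂ} (hβ : ContDiff ℝ (⊤ : ℕ∞) β) (c : ℝ) :
    ContDiff ℝ (⊤ : ℕ∞) (fun t => ∫ s in c..t, β s) ∧ deriv (fun t => ∫ s in c..t, β s) = β := by
  have hd : ∀ t, HasDerivAt (fun t => ∫ s in c..t, β s) (β t) t := fun t =>
    (hβ.continuous.integral_hasStrictDerivAt c t).hasDerivAt
  have he : deriv (fun t => ∫ s in c..t, β s) = β := funext fun t => (hd t).deriv
  refine ⟨contDiff_infty_iff_deriv.2 ⟨fun t => (hd t).differentiableAt, ?_⟩, he⟩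
  rw [he]
  exact hβ

/-- Primitives are based at `b`, so they still vanish to the right of `b`. -/
theorem exists_iteratedDeriv_eq {β : ℝ → ℂ} (hβ : ContDiff ℝ (⊤ : ℕ∞) β) {b : ℝ}
    (hb : ∀ t, b ≤ t → β t = 0) (n : ℕ) :
    ∃ φ : ℝ → ℂ, ContDiff ℝ (⊤ : ℕ∞) φ ∧ (∀ t, b ≤ t → φ t = 0) ∧ iteratedDeriv n φ = β := by
  induction n with
  | zero => exact ⟨β, hβ, hb, by simp⟩
  | succ n ih =>
    obtain ⟨φ, hφ, h0, hn⟩ := ih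
    refine ⟨fun t => ∫ s in b..t, φ s, (contDiff_primitive hφ b).1, fun t ht => ?_, ?_⟩
    · simp only
      rw [intervalIntegral.integral_congr (g := fun _ => 0)]
      · simp
      · intro s hs
        rw [uIcc_of_le ht] at hs
        exact h0 s hs.1
    · rw [iteratedDeriv_succ', (contDiff_primitive hφ b).2, hn]

theorem exists_testFn_iteratedDeriv_eq {β : ℝ → ℂ} (hβ : ContDiff ℝ (⊤ : ℕ∞) β) {b τ : ℝ}
    (hτ : 0 < τ) (hbτ : b < τ) (hb : ∀ t, b ≤ t → β t = 0) (n : ℕ) :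
    ∃ φ : TestFn, tsupport φ ⊆ Ioo (-τ) τ ∧
      ∀ j, ∀ t, 0 ≤ t → iteratedDeriv (n + j) φ t = iteratedDeriv j β t := by
  obtain ⟨φ₀, hφ₀, h0, hn⟩ := exists_iteratedDeriv_eq hβ hb n
  -- The iterated primitive need not vanish far to the left. It is cut off strictly below `0`, which
  -- leaves all derivatives on `[0, ∞)` unchanged, including those at `0`.
  obtain ⟨χ, hχ, hχ0, hχ1⟩ := exists_smooth_step (a := -(τ / 2)) (b := -(τ / 4)) (by linarith)
  obtain ⟨φ, hφ, hs⟩ := TestFn.of_eqOn_compl_Icc (a := -(τ / 2)) (b := b)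
    (hχ.mul hφ₀) (fun t ht => by
      simp only [mem_Icc, not_and_or, not_le] at ht
      rcases ht with ht | ht
      · simp [hχ0 t ht.le]
      · simp [h0 t ht.le])
  refine ⟨φ, hs.trans fun t ht => ⟨by linarith [ht.1], by linarith [ht.2]⟩, fun j t ht => ?_⟩
  have : ⇑φ =ᶠ[𝓝 t] φ₀ := by
    filter_upwards [Ioi_mem_nhds (show -(τ / 4) < t by linarith)] with s hs
    simp [hφ, hχ1 s (le_of_lt hs)]
  rw [this.iteratedDeriv_eq, ← hn, iteratedDeriv_eq_iterate, iteratedDeriv_eq_iterate,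
    iteratedDeriv_eq_iterate, ← Function.iterate_add_apply, add_comm]

theorem eqOn_zero_of_integral_smooth_mul {k : ℝ → ℂ} (hk : Continuous k) {a b : ℝ}
    (h : ∀ β : TestFn, tsupport β ⊆ Ioo a b → ∫ s, β s * k s = 0) :
    ∀ t ∈ Ioo a b, k t = 0 := by
  have hae := isOpen_Ioo.ae_eq_zero_of_integral_contDiff_smul_eq_zero (U := Ioo a b) (μ := volume)
    (hk.locallyIntegrable.locallyIntegrableOn _) (fun g hg hc hs => by
      have hsupp : Function.support (fun t => (g t : ℂ)) = Function.support g := by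
        ext t; simp
      obtain ⟨β, hβ⟩ := TestFn.exists_coe_eq (f := fun t => (g t : ℂ))
        (Complex.ofRealCLM.contDiff.comp hg)
        (by rw [HasCompactSupport, tsupport, hsupp]; exact hc)
      have := h β (by rw [hβ, tsupport, hsupp]; exact hs)
      simpa [hβ] using this)
  have := Measure.eqOn_open_of_ae_eq (f := k) (g := fun _ => 0) (μ := volume)
    ((ae_restrict_iff' measurableSet_Ioo).2 hae) isOpen_Ioo hk.continuousOn continuousOn_const
  exact fun t ht => this ht

theorem integral_eq_intervalIntegral_of_tsupport {f : ℝ → ℂ} {a b : ℝ} (hab : a ≤ b)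
    (h : ∀ t, t ∉ Ioc a b → f t = 0) : ∫ s, f s = ∫ s in a..b, f s := by
  rw [intervalIntegral.integral_of_le hab]
  exact (setIntegral_eq_integral_of_forall_compl_eq_zero h).symm

/-- No polynomial ambiguity arises, because `φ` is free near `0`: every smooth `β` supported in `(0,
τ)` agrees on `[0, ∞)` with the `n`-th derivative of an admissible `φ`. Since `β` is flat at `0`,
test functions with vanishing derivatives of order at least `n` at `0` suffice; the kernel-space
criterion needs this refinement. -/
theorem eqOn_zero_of_integral_iteratedDeriv_mul {k : ℝ → ℂ} (hk : Continuous k) {τ : ℝ}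
    (hτ : 0 < τ) (n : ℕ) (h : ∀ φ : TestFn, tsupport φ ⊆ Ioo (-τ) τ →
      (∀ j, n ≤ j → iteratedDeriv j φ 0 = 0) →
        ∫ s in (0 : ℝ)..τ, iteratedDeriv n φ s * k s = 0) :
    ∀ t ∈ Ico 0 τ, k t = 0 := by
  have h1 : ∀ t ∈ Ioo 0 τ, k t = 0 := by
    refine eqOn_zero_of_integral_smooth_mul hk fun β hβ => ?_
    obtain ⟨c, d, hc, hcd, hd, hs⟩ := TestFn.exists_Icc hτ hβ
    have hz : ∀ t, t ∉ Icc c d → β t = 0 := fun t ht => eq_zero_of_tsupport_subset hs ht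
    obtain ⟨φ, hφ, hj⟩ := exists_testFn_iteratedDeriv_eq β.smooth hτ
      -- A point strictly beyond `d`, since `β` is only known to vanish off the closed interval.
      (b := (d + τ) / 2) (by linarith)
      (fun t ht => hz t fun hm => by linarith [hm.2]) n
    have h0 : ∀ j, iteratedDeriv j β 0 = 0 := fun j => by
      have : ⇑β =ᶠ[𝓝 0] fun _ => 0 := by
        filter_upwards [Iio_mem_nhds hc] with s hs
        exact hz s fun hm => absurd hm.1 (not_le.2 hs)
      rw [this.iteratedDeriv_eq]
      simp
    have := h φ hφ fun j hnj => by
      obtain ⟨i, rfl⟩ := Nat.exists_eq_add_of_le hnj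
      rw [hj i 0 le_rfl, h0]
    rw [integral_eq_intervalIntegral_of_tsupport hτ.le, ← this]
    · refine intervalIntegral.integral_congr fun s hs => ?_
      rw [uIcc_of_le hτ.le] at hs
      have := hj 0 s hs.1
      simp only [add_zero, iteratedDeriv_zero] at this
      simp only [this]
    · intro t ht
      rw [hz t fun hm => ht ⟨by linarith [hm.1], by linarith [hm.2]⟩, zero_mul]
  have h2 : closure (Ioo 0 τ) ⊆ {t | k t = 0} :=
    closure_minimal h1 (isClosed_eq hk continuous_const)
  intro t ht
  refine h2 ?_
  rw [closure_Ioo hτ.ne]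
  exact ⟨ht.1, ht.2.le⟩

/-! ### The lemma of du Bois-Reymond -/

theorem TestFn.integrable_iteratedDeriv_mul (φ : TestFn) (n : ℕ) {f : ℝ → ℂ} (hf : Continuous f) :
    Integrable fun s => iteratedDeriv n φ s * f s := by
  have hc : HasCompactSupport (iteratedDeriv n φ) := by
    induction n with
    | zero => simpa using φ.hasCompactSupport
    | succ n ih =>
      rw [iteratedDeriv_succ]
      exact ih.deriv
  exact ((φ.smooth.iteratedDeriv_top n).continuous.mul hf).integrable_of_hasCompactSupport
    hc.mul_right

theorem TestFn.integral_iteratedDeriv_mul (φ : TestFn) (n : ℕ) {f : ℝ → ℂ}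
    (hf : ContDiff ℝ (⊤ : ℕ∞) f) :
    ∫ s, iteratedDeriv n φ s * f s = (-1) ^ n * ∫ s, φ s * iteratedDeriv n f s := by
  induction n generalizing f with
  | zero => simp
  | succ n ih =>
    have hd := contDiff_infty_iff_deriv.1 hf
    have := integral_mul_deriv_eq_deriv_mul_of_integrable (u := f) (u' := deriv f)
      (v := iteratedDeriv n φ) (v' := iteratedDeriv (n + 1) φ)
      (fun x _ => (hd.1 x).hasDerivAt) (fun x _ => φ.smooth.hasDerivAt_iteratedDeriv n x)
      (by rw [mul_comm f]; exact φ.integrable_iteratedDeriv_mul (n + 1) hf.continuous)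
      (by rw [mul_comm (deriv f)]; exact φ.integrable_iteratedDeriv_mul n hd.2.continuous)
      (by rw [mul_comm f]; exact φ.integrable_iteratedDeriv_mul n hf.continuous)
    rw [iteratedDeriv_succ' (f := f)]
    have e1 : ∫ s, iteratedDeriv (n + 1) φ s * f s = ∫ s, f s * iteratedDeriv (n + 1) φ s := by
      simp only [mul_comm]
    have e2 : ∫ s, deriv f s * iteratedDeriv n φ s = ∫ s, iteratedDeriv n φ s * deriv f s := by
      simp only [mul_comm]
    rw [e1, this, e2, ih hd.2]
    ring

theorem TestFn.exists_derivative_eq {β : TestFn} {a b : ℝ} (hab : a < b)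
    (hβ : tsupport β ⊆ Ioo a b) (h0 : ∫ s, β s = 0) :
    ∃ φ : TestFn, tsupport φ ⊆ Ioo a b ∧ deriv φ = β := by
  obtain ⟨c, d, hac, hcd, hdb, hs⟩ := TestFn.exists_Icc hab hβ
  have hz : ∀ t, t ∉ Icc c d → β t = 0 := fun t ht => eq_zero_of_tsupport_subset hs ht
  have hp := contDiff_primitive β.smooth a
  obtain ⟨φ, hφ, hφs⟩ := TestFn.of_eqOn_compl_Icc (a := c) (b := d) hp.1 (fun t ht => by
    simp only [mem_Icc, not_and_or, not_le] at ht
    rcases ht with ht | ht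
    · rw [intervalIntegral.integral_congr (g := fun _ => 0)]
      · simp
      · intro s hs
        refine hz s fun hm => ?_
        rcases mem_uIcc.1 hs with h | h <;> linarith [h.2, hm.1]
    · rw [← integral_eq_intervalIntegral_of_tsupport (by linarith), h0]
      intro s hs
      refine hz s fun hm => hs ⟨by linarith [hm.1], by linarith [hm.2]⟩)
  refine ⟨φ, hφs.trans fun t ht => ⟨by linarith [ht.1], by linarith [ht.2]⟩, ?_⟩
  rw [hφ, hp.2]

theorem TestFn.exists_integral_eq_one {a b : ℝ} (hab : a < b) :
    ∃ ρ : TestFn, tsupport ρ ⊆ Ioo a b ∧ ∫ s, ρ s = 1 := by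
  let χ : ContDiffBump ((a + b) / 2) :=
    ⟨(b - a) / 8, (b - a) / 4, by linarith, by linarith⟩
  have hsm : ContDiff ℝ (⊤ : ℕ∞) fun t => ((χ.normed volume t : ℝ) : ℂ) :=
    Complex.ofRealCLM.contDiff.comp χ.contDiff_normed
  obtain ⟨ρ, hρ, hs⟩ := TestFn.of_eqOn_compl_Icc (a := (a + b) / 2 - (b - a) / 4)
    (b := (a + b) / 2 + (b - a) / 4) hsm (fun t ht => by
      have : t ∉ Function.support (χ.normed volume) := by
        rw [χ.support_normed_eq, Real.ball_eq_Ioo]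
        exact fun hm => ht ⟨hm.1.le, hm.2.le⟩
      simpa using this)
  refine ⟨ρ, hs.trans fun t ht => ⟨by linarith [ht.1], by linarith [ht.2]⟩, ?_⟩
  rw [hρ, integral_complex_ofReal, χ.integral_normed]
  simp

theorem contDiff_polynomial_eval (p : Polynomial ℂ) :
    ContDiff ℝ (⊤ : ℕ∞) fun t : ℝ => p.eval (t : ℂ) := by
  simp only [Polynomial.eval_eq_sum_range]
  exact ContDiff.sum fun i _ => contDiff_const.mul (Complex.ofRealCLM.contDiff.pow i)

/-- Subtracting from `ψ` its integral times a fixed `ρ` of integral one leaves the derivative of a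
test function. Hence on `n`-th derivatives `c` acts as a multiple of `∫ ψ`, which a monomial of
degree `n` also does; removing that monomial lowers the order by one. -/
theorem exists_polynomial_of_integral_iteratedDeriv_mul {a b : ℝ} (hab : a < b) (n : ℕ)
    {c : ℝ → ℂ} (hc : Continuous c)
    (h : ∀ φ : TestFn, tsupport φ ⊆ Ioo a b → ∫ s, iteratedDeriv n φ s * c s = 0) :
    ∃ p : Polynomial ℂ, p.degree < n ∧ ∀ t ∈ Ioo a b, c t = p.eval (t : ℂ) := by
  induction n generalizing c with
  | zero =>
    refine ⟨0, by simp, ?_⟩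
    simpa using eqOn_zero_of_integral_smooth_mul hc (by simpa using h)
  | succ n ih =>
    obtain ⟨ρ, hρ, hρ1⟩ := TestFn.exists_integral_eq_one hab
    obtain ⟨K, hK⟩ : ∃ K, K = ∫ s, iteratedDeriv n ρ s * c s := ⟨_, rfl⟩
    have hdp := (contDiff_dividedPow n).continuous
    -- The sign compensates `∫ ψ⁽ⁿ⁾ tⁿ / n! = (-1)ⁿ ∫ ψ`.
    obtain ⟨p, hp, hpc⟩ := ih (c := fun t => c t - (-1) ^ n * K * dividedPow n t)
      (hc.sub (continuous_const.mul hdp)) (fun ψ hψ => by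
        have hsm : ContDiff ℝ (⊤ : ℕ∞) fun t => ψ t - (∫ s, ψ s) * ρ t :=
          ψ.smooth.sub (contDiff_const.mul ρ.smooth)
        have hcs : HasCompactSupport fun t => ψ t - (∫ s, ψ s) * ρ t :=
          ψ.hasCompactSupport.sub ρ.hasCompactSupport.mul_left
        obtain ⟨θ, hθ⟩ := TestFn.exists_coe_eq hsm hcs
        have hsub : tsupport θ ⊆ Ioo a b := by
          have : tsupport θ ⊆ tsupport ψ ∪ tsupport ρ := by
            refine closure_minimal (fun t ht => ?_)
              ((isClosed_tsupport _).union (isClosed_tsupport _))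
            by_contra hn
            rw [mem_union, not_or] at hn
            exact ht (by simp [hθ, image_eq_zero_of_notMem_tsupport hn.1,
              image_eq_zero_of_notMem_tsupport hn.2])
          exact this.trans (union_subset hψ hρ)
        obtain ⟨φ, hφ, hφd⟩ := TestFn.exists_derivative_eq hab hsub (by
          rw [hθ, integral_sub ψ.integrable (ρ.integrable.const_mul _), integral_const_mul, hρ1]
          simp)
        have h1 := h φ hφ
        rw [iteratedDeriv_succ', hφd, hθ] at h1
        have h2 : ∀ s, iteratedDeriv n (fun t => ψ t - (∫ s, ψ s) * ρ t) s * c s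
            = iteratedDeriv n ψ s * c s - (∫ s, ψ s) * (iteratedDeriv n ρ s * c s) := fun s => by
          have c1 : ContDiffAt ℝ (n : WithTop ℕ∞) ψ s :=
            (ψ.smooth.of_le (by exact_mod_cast le_top)).contDiffAt
          have c2 : ContDiffAt ℝ (n : WithTop ℕ∞) ρ s :=
            (ρ.smooth.of_le (by exact_mod_cast le_top)).contDiffAt
          rw [iteratedDeriv_fun_sub c1 (contDiffAt_const.mul c2), iteratedDeriv_const_mul_field]
          ring
        simp only [h2] at h1
        rw [integral_sub (ψ.integrable_iteratedDeriv_mul n hc)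
          ((ρ.integrable_iteratedDeriv_mul n hc).const_mul _), integral_const_mul, ← hK] at h1
        have h3 := ψ.integral_iteratedDeriv_mul n (contDiff_dividedPow n)
        have h4 : iteratedDeriv n (dividedPow n) = dividedPow 0 := by
          simpa using iteratedDeriv_dividedPow 0 n
        simp only [h4, dividedPow_zero_left, mul_one] at h3
        have h5 : ∀ s, iteratedDeriv n ψ s * (c s - (-1) ^ n * K * dividedPow n s)
            = iteratedDeriv n ψ s * c s
              - ((-1) ^ n * K) * (iteratedDeriv n ψ s * dividedPow n s) := fun s => by ring
        simp only [h5]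
        rw [integral_sub (ψ.integrable_iteratedDeriv_mul n hc)
          ((ψ.integrable_iteratedDeriv_mul n hdp).const_mul _), integral_const_mul, h3]
        have h6 : ((-1 : ℂ) ^ n) * (-1) ^ n = 1 := by rw [← mul_pow]; simp
        linear_combination h1 - K * (∫ s, ψ s) * h6)
    refine ⟨p + Polynomial.C ((-1) ^ n * K / n.factorial) * Polynomial.X ^ n, ?_, fun t ht => ?_⟩
    · refine (Polynomial.degree_add_le _ _).trans_lt (max_lt ?_ ?_)
      · exact hp.trans (by exact_mod_cast n.lt_succ_self)
      · exact (Polynomial.degree_C_mul_X_pow_le _ _).trans_lt (by exact_mod_cast n.lt_succ_self)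
    · have := hpc t ht
      simp only [Polynomial.eval_add, Polynomial.eval_mul, Polynomial.eval_C, Polynomial.eval_pow,
        Polynomial.eval_X, ← this, dividedPow]
      ring

theorem iteratedDeriv_polynomial_eval (p : Polynomial ℂ) (n : ℕ) :
    iteratedDeriv n (fun t : ℝ => p.eval (t : ℂ))
      = fun t : ℝ => ((Polynomial.derivative^[n]) p).eval (t : ℂ) := by
  induction n generalizing p with
  | zero => simp
  | succ n ih =>
    have : deriv (fun t : ℝ => p.eval (t : ℂ)) = fun t : ℝ => p.derivative.eval (t : ℂ) :=
      funext fun t => ((p.hasDerivAt (t : ℂ)).comp_ofReal).deriv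
    rw [iteratedDeriv_succ', this, ih, Function.iterate_succ_apply]

theorem TestFn.integral_iteratedDeriv_mul_polynomial (φ : TestFn) {n : ℕ} {p : Polynomial ℂ}
    (hp : p.degree < n) : ∫ s, iteratedDeriv n φ s * p.eval (s : ℂ) = 0 := by
  rw [φ.integral_iteratedDeriv_mul n (contDiff_polynomial_eval p), iteratedDeriv_polynomial_eval,
    Polynomial.iterate_derivative_eq_zero_of_degree_lt hp]
  simp

/-! ### Integrals of continuous functions with values in locally convex spaces -/

theorem norm_riemannSum_sub_integral_le {F : Type*} [NormedAddCommGroup F] [NormedSpace ℝ F]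
    [CompleteSpace F] {c : ℝ → F} (hc : Continuous c) {M : ℕ} (hM : 0 < M) {ε : ℝ}
    (h : ∀ r ∈ Icc (0 : ℝ) 1, ∀ r' ∈ Icc (0 : ℝ) 1, |r - r'| ≤ 1 / M → ‖c r - c r'‖ ≤ ε) :
    ‖(M : ℝ)⁻¹ • ∑ i ∈ Finset.range M, c (i / M) - ∫ s in (0 : ℝ)..1, c s‖ ≤ ε := by
  have hM' : (0 : ℝ) < M := by exact_mod_cast hM
  have hsum := intervalIntegral.sum_integral_adjacent_intervals (μ := volume) (f := c)
    (a := fun i : ℕ => (i : ℝ) / M) (n := M) (fun i _ => hc.intervalIntegrable _ _)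
  simp only [Nat.cast_zero, zero_div, div_self hM'.ne'] at hsum
  have hlen : ∀ i : ℕ, ((i + 1 : ℕ) : ℝ) / M - (i : ℝ) / M = (M : ℝ)⁻¹ := fun i => by
    push_cast
    field_simp
    ring
  have hcell : ∀ i ∈ Finset.range M,
      ‖(M : ℝ)⁻¹ • c (i / M) - ∫ s in ((i : ℝ) / M)..(((i + 1 : ℕ) : ℝ) / M), c s‖
        ≤ ε * (M : ℝ)⁻¹ := by
    intro i hi
    rw [Finset.mem_range] at hi
    have hi' : ((i + 1 : ℕ) : ℝ) ≤ M := by exact_mod_cast hi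
    have h1 : ∫ s in ((i : ℝ) / M)..(((i + 1 : ℕ) : ℝ) / M), c (i / M) = (M : ℝ)⁻¹ • c (i / M) := by
      rw [intervalIntegral.integral_const, hlen]
    rw [← h1, ← intervalIntegral.integral_sub intervalIntegrable_const
      (hc.intervalIntegrable _ _)]
    refine (intervalIntegral.norm_integral_le_of_norm_le_const (C := ε) fun s hs => ?_).trans ?_
    · have hle : (i : ℝ) / M ≤ ((i + 1 : ℕ) : ℝ) / M := by
        have := hlen i
        have : 0 < (M : ℝ)⁻¹ := inv_pos.2 hM'
        linarith
      rw [uIoc_of_le hle] at hs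
      have h0 : 0 ≤ (i : ℝ) / M := by positivity
      have h2 : ((i + 1 : ℕ) : ℝ) / M ≤ 1 := (div_le_one hM').2 hi'
      refine h _ ⟨h0, hle.trans h2⟩ _ ⟨h0.trans hs.1.le, hs.2.trans h2⟩ ?_
      rw [abs_sub_comm, abs_of_nonneg (by linarith [hs.1]), one_div, ← hlen i]
      linarith [hs.2]
    · rw [hlen, abs_of_pos (inv_pos.2 hM')]
  rw [← hsum, Finset.smul_sum, ← Finset.sum_sub_distrib]
  refine (norm_sum_le _ _).trans ((Finset.sum_le_sum hcell).trans ?_)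
  rw [Finset.sum_const, Finset.card_range, nsmul_eq_mul]
  refine le_of_eq ?_
  field_simp

/-- The Riemann sum of `g` over `[0, 1]` with `N + 1` equal cells. -/
noncomputable def riemannSum {X : Type*} [AddCommGroup X] [Module ℂ X] (g : ℝ → X) (N : ℕ) : X :=
  ((N + 1 : ℕ) : ℂ)⁻¹ • ∑ i ∈ Finset.range (N + 1), g (i / (N + 1 : ℕ))

theorem riemannSum_map {X Y : Type*} [AddCommGroup X] [Module ℂ X] [AddCommGroup Y] [Module ℂ Y]
    (l : X →ₗ[ℂ] Y) (g : ℝ → X) (N : ℕ) : l (riemannSum g N) = riemannSum (fun s => l (g s)) N := by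
  simp [riemannSum, map_smul, map_sum]

theorem riemannSum_complex (c : ℝ → ℂ) (N : ℕ) : riemannSum c N
    = ((N + 1 : ℕ) : ℝ)⁻¹ • ∑ i ∈ Finset.range (N + 1), c (i / (N + 1 : ℕ)) := by
  simp [riemannSum]

theorem tendsto_riemannSum {c : ℝ → ℂ} (hc : Continuous c) :
    Tendsto (riemannSum c) atTop (𝓝 (∫ s in (0 : ℝ)..1, c s)) := by
  have huc := isCompact_Icc.uniformContinuousOn_of_continuous (s := Icc (0 : ℝ) 1) hc.continuousOn
  rw [Metric.uniformContinuousOn_iff_le] at huc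
  rw [Metric.tendsto_atTop']
  intro ε hε
  obtain ⟨δ, hδ, h⟩ := huc (ε / 2) (by linarith)
  obtain ⟨N, hN⟩ := exists_nat_one_div_lt hδ
  refine ⟨N, fun n hn => ?_⟩
  rw [dist_eq_norm]
  refine lt_of_le_of_lt ?_ (half_lt_self hε)
  have := norm_riemannSum_sub_integral_le hc n.succ_pos (ε := ε / 2) fun r hr r' hr' hrr => by
    rw [← dist_eq_norm]
    refine h r hr r' hr' ?_
    rw [Real.dist_eq]
    refine hrr.trans (le_trans ?_ hN.le)
    push_cast
    gcongr
  rwa [riemannSum_complex]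

theorem apply_eq_integral_of_tendsto_riemannSum {E : Type*} [AddCommGroup E] [Module ℂ E]
    [TopologicalSpace E] {g : ℝ → E} (hg : Continuous g) {v : E}
    (hv : Tendsto (riemannSum g) atTop (𝓝 v)) (l : E →L[ℂ] ℂ) :
    l v = ∫ s in (0 : ℝ)..1, l (g s) := by
  refine tendsto_nhds_unique ((l.continuous.tendsto v).comp hv) ?_
  have := tendsto_riemannSum (l.continuous.comp hg)
  refine this.congr fun N => ?_
  exact (riemannSum_map (l : E →ₗ[ℂ] ℂ) g N).symm

theorem integral_zero_one_smul_comp_mul (c : ℝ → ℂ) (t : ℝ) :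
    ∫ y in (0 : ℝ)..1, (t : ℂ) * c (t * y) = ∫ s in (0 : ℝ)..t, c s := by
  have := intervalIntegral.smul_integral_comp_mul_left (a := 0) (b := 1) c t
  rw [mul_zero, mul_one] at this
  rw [← this, intervalIntegral.integral_const_mul, Complex.real_smul]

section LocallyConvex

variable {E : Type*} [AddCommGroup E] [Module ℂ E] [UniformSpace E] [IsUniformAddGroup E]
  [ContinuousSMul ℂ E] [Module ℝ E] [IsScalarTower ℝ ℂ E] [LocallyConvexSpace ℝ E]

theorem exists_isClosed_convex_subset {U : Set E} (hU : U ∈ 𝓝 (0 : E)) :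
    ∃ W ∈ 𝓝 (0 : E), IsClosed W ∧ Convex ℝ W ∧ W ⊆ U := by
  have := IsScalarTower.continuousSMul (M := ℝ) (α := E) ℂ
  obtain ⟨K, hK, hKc, hKU⟩ := exists_mem_nhds_isClosed_subset hU
  obtain ⟨V, ⟨hV, hVc⟩, hVK⟩ := (LocallyConvexSpace.convex_basis_zero ℝ E).mem_iff.1 hK
  exact ⟨closure V, mem_of_superset hV subset_closure, isClosed_closure, hVc.closure,
    (closure_minimal hVK hKc).trans hKU⟩

/-- Hahn–Banach separation. `W` need not be symmetric, so the two-sided bound is asked only where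
both `y` and `-y` lie in `W`. -/
theorem exists_abs_re_le_of_notMem {W : Set E} (hWc : IsClosed W) (hW : Convex ℝ W) {x : E}
    (hx : x ∉ W) : ∃ (l : E →L[ℂ] ℂ) (u : ℝ), u < (l x).re ∧
      ∀ y, y ∈ W → -y ∈ W → |(l y).re| ≤ u := by
  obtain ⟨l, u, h1, h2⟩ := RCLike.geometric_hahn_banach_closed_point (𝕜 := ℂ) hW hWc hx
  refine ⟨l, u, h2, fun y hy hy' => abs_le.2 ⟨?_, (h1 y hy).le⟩⟩
  have := h1 _ hy'
  simp only [map_neg, RCLike.re_eq_complex_re] at this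
  linarith

/-- If the difference of two fine Riemann sums left a closed convex `W`, a separating functional
would exceed some `u` on it; but uniform continuity puts the real part of each sum within `u / 2` of
the same scalar integral. -/
theorem cauchySeq_riemannSum {g : ℝ → E} (hg : Continuous g) : CauchySeq (riemannSum g) := by
  rw [cauchySeq_iff]
  intro V hV
  rw [uniformity_eq_comap_nhds_zero, mem_comap] at hV
  obtain ⟨U, hU, hUV⟩ := hV
  obtain ⟨W, hW, hWc, hWx, hWU⟩ := exists_isClosed_convex_subset hU
  -- The factor `2` leaves an error `u / 2` for each of the two sums.
  have hY : {y : E | (2 : ℂ) • y ∈ W ∧ -((2 : ℂ) • y) ∈ W} ∈ 𝓝 (0 : E) := by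
    have c1 : ContinuousAt (fun y : E => (2 : ℂ) • y) 0 := (continuous_const_smul _).continuousAt
    have c2 : ContinuousAt (fun y : E => -((2 : ℂ) • y)) 0 := c1.neg
    refine inter_mem (c1 ?_) (c2 ?_) <;> simpa using hW
  have huc := isCompact_Icc.uniformContinuousOn_of_continuous (s := Icc (0 : ℝ) 1) hg.continuousOn
  have hE : {p : E × E | p.2 - p.1 ∈ {y : E | (2 : ℂ) • y ∈ W ∧ -((2 : ℂ) • y) ∈ W}}
      ∈ uniformity E := by
    rw [uniformity_eq_comap_nhds_zero]
    exact preimage_mem_comap hY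
  have hpre := huc hE
  rw [mem_map, mem_inf_principal, Metric.mem_uniformity_dist] at hpre
  obtain ⟨δ, hδ, h⟩ := hpre
  obtain ⟨N, hN⟩ := exists_nat_one_div_lt hδ
  refine ⟨N, fun k hk m hm => hUV (hWU ?_)⟩
  by_contra hn
  obtain ⟨l, u, hu, hl⟩ := exists_abs_re_le_of_notMem hWc hWx hn
  have hc : Continuous fun s => (l (g s)).re := Complex.continuous_re.comp (l.continuous.comp hg)
  have key : ∀ n, N ≤ n →
      |(l (riemannSum g n)).re - ∫ s in (0 : ℝ)..1, (l (g s)).re| ≤ u / 2 := fun n hn => by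
    have := norm_riemannSum_sub_integral_le hc n.succ_pos (ε := u / 2) fun r hr r' hr' hrr => by
      have hd : dist r' r < δ := by
        rw [dist_comm, Real.dist_eq]
        refine hrr.trans_lt (lt_of_le_of_lt ?_ hN)
        push_cast
        gcongr
      have h2 := h hd ⟨hr', hr⟩
      have h3 := hl _ h2.1 h2.2
      rw [map_smul, smul_eq_mul, map_sub] at h3
      have h4 : ((2 : ℂ) * (l (g r) - l (g r'))).re = 2 * ((l (g r)).re - (l (g r')).re) := by
        simp
      rw [h4, abs_mul, abs_two] at h3
      rw [Real.norm_eq_abs]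
      linarith
    rw [Real.norm_eq_abs] at this
    convert this using 3
    rw [← ContinuousLinearMap.coe_coe, riemannSum_map, riemannSum]
    have e : ((n + 1 : ℕ) : ℂ)⁻¹ = (((n + 1 : ℕ) : ℝ)⁻¹ : ℝ) := by push_cast; rfl
    rw [e, smul_eq_mul, Complex.re_ofReal_mul, Complex.re_sum]
    rfl
  have h1 := abs_le.1 (key k hk)
  have h2 := abs_le.1 (key m hm)
  simp only [map_sub, Complex.sub_re] at hu
  linarith [h1.1, h1.2, h2.1, h2.2]

theorem exists_hasSetIntegral_Icc (hE : IsSeqComplete E) {g : ℝ → E} (hg : Continuous g) {t : ℝ}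
    (ht : 0 ≤ t) : ∃ v, HasSetIntegral (Icc 0 t) g v ∧
      ∀ l : E →L[ℂ] ℂ, l v = ∫ s in (0 : ℝ)..t, l (g s) := by
  have hg' : Continuous fun y : ℝ => (t : ℂ) • g (t * y) := by fun_prop
  obtain ⟨v, hv⟩ := hE _ (cauchySeq_riemannSum hg')
  have key : ∀ l : E →L[ℂ] ℂ, l v = ∫ s in (0 : ℝ)..t, l (g s) := fun l => by
    rw [apply_eq_integral_of_tendsto_riemannSum hg' hv,
      ← integral_zero_one_smul_comp_mul (fun s => l (g s))]
    simp
  refine ⟨v, fun l => ⟨(l.continuous.comp hg).integrableOn_Icc, ?_⟩, key⟩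
  rw [key, intervalIntegral.integral_of_le ht, integral_Icc_eq_integral_Ioc]

theorem eq_of_forall_apply_eq [T2Space E] {x y : E} (h : ∀ l : E →L[ℂ] ℂ, l x = l y) : x = y := by
  by_contra hne
  obtain ⟨l, hl⟩ := RCLike.geometric_hahn_banach_point_point (𝕜 := ℂ) hne
  rw [h l] at hl
  exact hl.false

/-- The image of `g` on a compact interval is bounded, hence absorbed by `W`; a separating
functional is then too small along `g` for a short integral to leave `W`. -/
theorem continuous_of_apply_eq_integral {g F : ℝ → E} (hg : Continuous g)
    (hF : ∀ t, ∀ l : E →L[ℂ] ℂ, l (F t) = ∫ s in (0 : ℝ)..t, l (g s)) : Continuous F := by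
  rw [continuous_iff_continuousAt]
  intro t₀
  rw [ContinuousAt, ← tendsto_sub_nhds_zero_iff]
  intro U hU
  obtain ⟨W, hW, hWc, hWx, hWU⟩ := exists_isClosed_convex_subset hU
  have hbd : Bornology.IsVonNBounded ℂ (g '' Icc (t₀ - 1) (t₀ + 1)) :=
    ((isCompact_Icc.image hg).totallyBounded).isVonNBounded ℂ
  have habs := (hbd hW).eventually_nhds_zero (mem_of_mem_nhds hW)
  rw [Metric.eventually_nhds_iff] at habs
  obtain ⟨δ, hδ, h⟩ := habs
  have hη : 0 < min 1 (δ / 2) := lt_min one_pos (by linarith)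
  rw [mem_map]
  filter_upwards [Metric.ball_mem_nhds t₀ hη] with t ht
  refine hWU ?_
  by_contra hn
  obtain ⟨l, u, hu, hl⟩ := exists_abs_re_le_of_notMem hWc hWx hn
  rw [Metric.mem_ball, Real.dist_eq] at ht
  have ht1 := ht.trans_le (min_le_left _ _)
  have ht2 := ht.trans_le (min_le_right _ _)
  have hc : Continuous fun s => l (g s) := l.continuous.comp hg
  have hu0 : 0 ≤ u := by
    have := hl 0 (mem_of_mem_nhds hW) (by simpa using mem_of_mem_nhds hW)
    simpa using this
  have hb : ∀ s ∈ Icc (t₀ - 1) (t₀ + 1), |(l (g s)).re| ≤ u / (δ / 2) := fun s hs => by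
    have m1 := h (y := ((δ / 2 : ℝ) : ℂ)) (by
      rw [dist_zero_right, Complex.norm_real, Real.norm_eq_abs, abs_of_pos] <;> linarith)
      (mem_image_of_mem g hs)
    have m2 := h (y := -((δ / 2 : ℝ) : ℂ)) (by
      rw [dist_zero_right, norm_neg, Complex.norm_real, Real.norm_eq_abs, abs_of_pos] <;> linarith)
      (mem_image_of_mem g hs)
    simp only [neg_smul] at m2
    have := hl _ m1 m2
    rw [map_smul, smul_eq_mul, Complex.re_ofReal_mul, abs_mul, abs_of_pos (by linarith)] at this
    rw [le_div_iff₀ (by linarith)]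
    linarith
  have e : l (F t - F t₀) = ∫ s in t₀..t, l (g s) := by
    rw [map_sub, hF, hF]
    exact intervalIntegral.integral_interval_sub_left (hc.intervalIntegrable _ _)
      (hc.intervalIntegrable _ _)
  have e2 : (∫ s in t₀..t, l (g s)).re = ∫ s in t₀..t, (l (g s)).re :=
    (Complex.reCLM.intervalIntegral_comp_comm (hc.intervalIntegrable _ _)).symm
  rw [e, e2] at hu
  have := intervalIntegral.norm_integral_le_of_norm_le_const (f := fun s => (l (g s)).re)
    (a := t₀) (b := t) (C := u / (δ / 2)) fun s hs => hb s ?_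
  · rw [Real.norm_eq_abs] at this
    have h1 : u / (δ / 2) * |t - t₀| ≤ u / (δ / 2) * (δ / 2) :=
      mul_le_mul_of_nonneg_left ht2.le (div_nonneg hu0 (by linarith))
    rw [div_mul_cancel₀ _ (by linarith)] at h1
    linarith [le_abs_self (∫ s in t₀..t, (l (g s)).re)]
  · have := abs_lt.1 ht1
    rcases mem_uIoc.1 hs with hs | hs <;> exact ⟨by linarith [hs.1], by linarith [hs.2]⟩

open scoped ComplexOrder in
theorem polynormableSpace_of_real : PolynormableSpace ℂ E := by
  have := IsScalarTower.continuousSMul (M := ℝ) (α := E) ℂ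
  have : LocallyConvexSpace ℂ E := by
    refine (locallyConvexSpace_iff_exists_convex_subset_zero ℂ E).2 fun U hU => ?_
    obtain ⟨W, hW, -, hWx, hWU⟩ := exists_isClosed_convex_subset hU
    exact ⟨W, hW, convex_of_nonneg_surjective_algebraMap _
      (fun _ hz => RCLike.nonneg_iff_exists_ofReal.mp hz) hWx, hWU⟩
  exact LocallyConvexSpace.toPolynormableSpace

/-- Riemann sums are continuous operators converging pointwise; by Banach–Steinhaus their limit is a
continuous operator. -/
theorem exists_operator_integral [T2Space E] [BarrelledSpace ℂ E] (hE : IsSeqComplete E)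
    {S : ℝ → (E →L[ℂ] E)} (hS : ∀ x, Continuous fun t => S t x) :
    ∃ F : ℝ → (E →L[ℂ] E), (∀ x, Continuous fun t => F t x) ∧
      ∀ t x, ∀ l : E →L[ℂ] ℂ, l (F t x) = ∫ s in (0 : ℝ)..t, l (S s x) := by
  have := IsScalarTower.continuousSMul (M := ℝ) (α := E) ℂ
  have : PolynormableSpace ℂ E := polynormableSpace_of_real
  have hc : ∀ (t : ℝ) (x : E), Continuous fun y : ℝ => (t : ℂ) • S (t * y) x := fun t x =>
    ((hS x).comp (continuous_const.mul continuous_id)).const_smul _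
  choose v hv using fun t x => hE _ (cauchySeq_riemannSum (hc t x))
  have happ : ∀ (t : ℝ) (x : E) (N : ℕ), riemannSum (fun y : ℝ => (t : ℂ) • S (t * y)) N x
      = riemannSum (fun y : ℝ => (t : ℂ) • S (t * y) x) N := fun t x N => by
    simp only [riemannSum, FunLike.coe_smul, Pi.smul_apply, sum_apply]
  have hlim : ∀ t : ℝ, Tendsto (fun N x => riemannSum (fun y : ℝ => (t : ℂ) • S (t * y)) N x) atTop
      (𝓝 (v t)) := fun t => tendsto_pi_nhds.2 fun x => by
    simp only [happ]
    exact hv t x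
  have hint : ∀ (t : ℝ) (x : E), ∀ l : E →L[ℂ] ℂ, l (v t x) = ∫ s in (0 : ℝ)..t, l (S s x) := fun t x l => by
    rw [apply_eq_integral_of_tendsto_riemannSum (hc t x) (hv t x),
      ← integral_zero_one_smul_comp_mul (fun s => l (S s x))]
    simp
  exact ⟨fun t => continuousLinearMapOfTendsto _ (hlim t),
    fun x => continuous_of_apply_eq_integral (hS x) fun t l => hint t x l, hint⟩

end LocallyConvex

/-! ### Representation of the distribution by a strongly continuous operator family -/

section Representation

variable {E : Type*} [AddCommGroup E] [Module ℂ E]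

/-- The functional `A ↦ l (A x)` on `L(E)`. -/
noncomputable def evalFunctional [TopologicalSpace E] [IsTopologicalAddGroup E]
    [ContinuousSMul ℂ E] (l : E →L[ℂ] ℂ) (x : E) : (E →L[ℂ] E) →L[ℂ] ℂ where
  toFun A := l (A x)
  map_add' A B := by simp
  map_smul' c A := by simp
  cont := l.continuous.comp (continuous_eval_const x)

/-- `G` is on `(-∞, τ)` weakly the `n`-th derivative of the strongly continuous family `S`,
extended by zero to the negative half-line. -/
structure IsDerivativeOf [TopologicalSpace E] [IsTopologicalAddGroup E] [ContinuousSMul ℂ E]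
    (n : ℕ) (τ : ℝ) (G : TestFn →L[ℂ] (E →L[ℂ] E)) (S : ℝ → (E →L[ℂ] E)) : Prop where
  continuous_apply : ∀ x, Continuous fun t => S t x
  apply_eq : ∀ φ : TestFn, tsupport φ ⊆ Iio τ → ∀ (x : E) (l : E →L[ℂ] ℂ),
    l (G φ x) = (-1) ^ n * ∫ s in (0 : ℝ)..τ, iteratedDeriv n φ s * l (S s x)

/-- The margin `ε` puts the closed support of `φ - ψ` inside the open negative half-line. -/
theorem Distribution.IsVanishingOn.congr_of_Ici {X : Type*} [AddCommGroup X] [Module ℂ X]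
    [TopologicalSpace X] {F : TestFn →L[ℂ] X}
    (hF : Distribution.IsVanishingOn F ((Ici 0)ᶜ : Set ℝ)) {φ ψ : TestFn} {ε : ℝ} (hε : 0 < ε)
    (h : ∀ t, -ε ≤ t → φ t = ψ t) : F φ = F ψ := by
  have hs : tsupport (φ - ψ : TestFn) ⊆ (Ici 0)ᶜ := by
    have : tsupport (φ - ψ : TestFn) ⊆ Iic (-ε) := by
      refine closure_minimal (fun t ht => ?_) isClosed_Iic
      by_contra hn
      refine ht ?_
      have := h t (le_of_lt (not_le.1 hn))
      simp [this]
    exact this.trans fun t ht => by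
      simp only [mem_Iic, mem_compl_iff, mem_Ici, not_le] at ht ⊢
      linarith
  have := hF _ hs
  rwa [map_sub, sub_eq_zero] at this

theorem eventuallyEq_iteratedDeriv_of_Ici {f g : ℝ → ℂ} {a : ℝ} (h : ∀ t, a ≤ t → f t = g t)
    (n : ℕ) {t : ℝ} (ht : a < t) : iteratedDeriv n f t = iteratedDeriv n g t := by
  refine Filter.EventuallyEq.iteratedDeriv_eq n ?_
  filter_upwards [Ioi_mem_nhds ht] with s hs using h s (le_of_lt hs)

theorem eq_zero_of_tsupport_subset_Iio {φ : ℝ → ℂ} {τ : ℝ} (h : tsupport φ ⊆ Iio τ) (t : ℝ)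
    (ht : τ ≤ t) : φ t = 0 :=
  eq_zero_of_tsupport_subset h (by simpa using ht)

/-- The integral in `L(E)` is tested on `A ↦ l (A x)`; clamping the argument to `[-τ, τ]` makes `f`
continuous on the line. -/
theorem IsOfFiniteOrder.exists_continuous_apply_eq [TopologicalSpace E] [IsTopologicalAddGroup E]
    [ContinuousSMul ℂ E] {G : TestFn →L[ℂ] (E →L[ℂ] E)}
    (hfin : IsOfFiniteOrder G) {τ : ℝ} (hτ : 0 < τ) :
    ∃ (n : ℕ) (f : ℝ → (E →L[ℂ] E)), (∀ x, Continuous fun t => f t x) ∧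
      ∀ φ : TestFn, tsupport φ ⊆ Ioo (-τ) τ → ∀ (x : E) (l : E →L[ℂ] ℂ),
        l (G φ x) = (-1) ^ n * ∫ s, iteratedDeriv n φ s * l (f s x) := by
  obtain ⟨n, f, hf, h⟩ := hfin τ hτ
  have hproj : ∀ t, max (-τ) (min t τ) ∈ Icc (-τ) τ := fun t =>
    ⟨le_max_left _ _, max_le (by linarith) (min_le_right _ _)⟩
  have hcf : Continuous fun t => f (max (-τ) (min t τ)) :=
    hf.comp_continuous (by fun_prop) hproj
  refine ⟨n, fun t => f (max (-τ) (min t τ)), fun x => (continuous_eval_const x).comp hcf,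
    fun φ hφ x l => ?_⟩
  obtain ⟨v, hv, hGv⟩ := h φ hφ
  have hl := (hv (evalFunctional l x)).2
  have e1 : l (G φ x) = (-1) ^ n * evalFunctional l x v := by
    rw [hGv]
    simp [evalFunctional]
  have hz : ∀ t, t ∉ Ioc (-τ) τ → iteratedDeriv n φ t = 0 := fun t ht => by
    refine image_eq_zero_of_notMem_tsupport fun hm => ht ?_
    have hsub : tsupport (iteratedDeriv n φ) ⊆ tsupport φ := by
      clear hm hl e1 hv hGv v h hf f hproj hcf
      induction n with
      | zero => simp
      | succ n ih =>
        rw [iteratedDeriv_succ]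
        exact tsupport_deriv_subset.trans ih
    exact Ioo_subset_Ioc_self (hφ (hsub hm))
  rw [e1, ← hl, integral_eq_intervalIntegral_of_tsupport (a := -τ) (b := τ) (by linarith)
    (fun t ht => by simp [hz t ht]), intervalIntegral.integral_of_le (by linarith),
    integral_Icc_eq_integral_Ioc]
  congr 1
  refine setIntegral_congr_fun measurableSet_Ioc fun t ht => ?_
  have : max (-τ) (min t τ) = t := by
    rw [min_eq_left ht.2, max_eq_right ht.1.le]
  simp [evalFunctional, this]

/-- Du Bois-Reymond on `(-τ, 0)` gives a polynomial for each pair `(x, l)`. Interpolating `f` at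
fixed nodes reproduces all of them at once by a single operator polynomial, which is then
subtracted. -/
theorem exists_isDerivativeOf_of_isOfFiniteOrder [TopologicalSpace E] [IsTopologicalAddGroup E]
    [ContinuousSMul ℂ E] {G : TestFn →L[ℂ] (E →L[ℂ] E)}
    (hsupp : Distribution.IsVanishingOn G ((Ici 0)ᶜ : Set ℝ)) (hfin : IsOfFiniteOrder G)
    {τ : ℝ} (hτ : 0 < τ) :
    ∃ (n : ℕ) (S : ℝ → (E →L[ℂ] E)), IsDerivativeOf n τ G S := by
  obtain ⟨n, f, hf, hG⟩ := hfin.exists_continuous_apply_eq hτ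
  -- For `i < n` these are `n` distinct nodes strictly inside `(-τ, 0)`, enough to determine a
  -- polynomial of degree below `n`.
  obtain ⟨ν, hν⟩ : ∃ ν : ℕ → ℝ, ν = fun i : ℕ => -τ * (i + 1) / (n + 1) := ⟨_, rfl⟩
  have hn1 : (0 : ℝ) < n + 1 := by positivity
  have hνmem : ∀ i ∈ Finset.range n, ν i ∈ Ioo (-τ) 0 := fun i hi => by
    have hi' : (i : ℝ) < n := by exact_mod_cast Finset.mem_range.1 hi
    have hi0 : (0 : ℝ) ≤ i := Nat.cast_nonneg i
    simp only [hν]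
    constructor
    · rw [lt_div_iff₀ hn1]
      nlinarith
    · rw [div_lt_iff₀ hn1]
      nlinarith
  have hνinj : Set.InjOn (fun i => (ν i : ℂ)) (Finset.range n) := fun i _ j _ hij => by
    have h1 : ν i = ν j := by
      simp only at hij
      exact_mod_cast hij
    simp only [hν] at h1
    field_simp at h1
    have h2 : (i : ℝ) = j := by linarith
    exact_mod_cast h2
  obtain ⟨P, hP⟩ : ∃ P : ℝ → (E →L[ℂ] E), P = fun t : ℝ => ∑ i ∈ Finset.range n,
      (Lagrange.basis (Finset.range n) (fun i => (ν i : ℂ)) i).eval (t : ℂ) • f (ν i) := ⟨_, rfl⟩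
  have hpoly : ∀ (x : E) (l : E →L[ℂ] ℂ), ∃ p : Polynomial ℂ, p.degree < n ∧
      (∀ t ∈ Icc (-τ) 0, l (f t x) = p.eval (t : ℂ)) ∧
        ∀ t : ℝ, l (P t x) = p.eval (t : ℂ) := by
    intro x l
    have hc : Continuous fun t => l (f t x) := l.continuous.comp (hf x)
    obtain ⟨p, hp, hpe⟩ := exists_polynomial_of_integral_iteratedDeriv_mul (a := -τ) (b := 0)
      (by linarith) n hc fun φ hφ => by
        have h1 := hG φ (hφ.trans (Ioo_subset_Ioo_right hτ.le)) x l
        rw [hsupp φ (hφ.trans fun t ht => by simpa using ht.2)] at h1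
        have h2 : ((-1 : ℂ) ^ n) ≠ 0 := pow_ne_zero _ (by norm_num)
        simpa [h2] using h1.symm
    refine ⟨p, hp, ?_, fun t => ?_⟩
    · have h2 : closure (Ioo (-τ) 0) ⊆ {t : ℝ | l (f t x) = p.eval (t : ℂ)} :=
        closure_minimal hpe (isClosed_eq hc (contDiff_polynomial_eval p).continuous)
      rw [closure_Ioo (by linarith)] at h2
      exact fun t ht => h2 ht
    · have h3 := Lagrange.eq_interpolate (f := p) hνinj (by simpa using hp)
      conv_rhs => rw [h3]
      rw [Lagrange.interpolate_apply, Polynomial.eval_finsetSum, hP]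
      simp only [sum_apply, FunLike.coe_smul, Pi.smul_apply, map_sum, map_smul, smul_eq_mul,
        Polynomial.eval_mul, Polynomial.eval_C]
      refine Finset.sum_congr rfl fun i hi => ?_
      rw [hpe _ (hνmem i hi), mul_comm]
  have hPc : ∀ x, Continuous fun t => P t x := fun x => by
    rw [hP]
    simp only [sum_apply, FunLike.coe_smul, Pi.smul_apply]
    exact continuous_finsetSum _ fun i _ =>
      (contDiff_polynomial_eval _).continuous.smul continuous_const
  refine ⟨n, fun t => f (max 0 t) - P (max 0 t), fun x => ?_, fun φ hφ x l => ?_⟩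
  · exact ((hf x).sub (hPc x)).comp (by fun_prop : Continuous fun t : ℝ => max 0 t)
  -- The support of `φ` may extend below `-τ`; cutting left of `0` does not alter `G φ`.
  · obtain ⟨ψ, hψ0, hψ1, hψs⟩ := φ.exists_cutoff (a := -(τ / 2)) (b := -(τ / 4)) (by linarith)
    have hψτ : tsupport ψ ⊆ Ioo (-τ) τ := by
      have : tsupport ψ ⊆ Ici (-(τ / 2)) := by
        refine closure_minimal (fun t ht => ?_) isClosed_Ici
        by_contra hn
        exact ht (hψ0 t (le_of_lt (not_le.1 hn)))
      intro t ht
      have h1 := this ht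
      simp only [mem_Ici] at h1
      exact ⟨by linarith, hφ (hψs ht)⟩
    rw [← hsupp.congr_of_Ici (show 0 < τ / 4 by linarith) hψ1, hG ψ hψτ x l]
    obtain ⟨p, hp, hp1, hp2⟩ := hpoly x l
    have hc : Continuous fun t => l (f t x) := l.continuous.comp (hf x)
    have hpc : Continuous fun t : ℝ => p.eval (t : ℂ) := (contDiff_polynomial_eval p).continuous
    have hψn := (ψ.smooth.iteratedDeriv_top n).continuous
    have e1 : ∫ s, iteratedDeriv n ψ s * l (f s x)
        = ∫ s, iteratedDeriv n ψ s * (l (f s x) - p.eval (s : ℂ)) := by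
      simp only [mul_sub]
      rw [integral_sub (ψ.integrable_iteratedDeriv_mul n hc)
        (ψ.integrable_iteratedDeriv_mul n hpc), ψ.integral_iteratedDeriv_mul_polynomial hp, sub_zero]
    have hz1 : ∀ t, τ ≤ t → iteratedDeriv n ψ t = 0 :=
      iteratedDeriv_eq_zero_of_le ψ.smooth
        (fun t ht => eq_zero_of_tsupport_subset hψτ fun hm => by linarith [hm.2]) n
    have hz2 : ∀ t, t ≤ -τ → iteratedDeriv n ψ t = 0 := fun t ht => by
      have : ⇑ψ =ᶠ[𝓝 t] fun _ => 0 := by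
        filter_upwards [Iio_mem_nhds (show t < -(τ / 2) by linarith)] with s hs
        exact hψ0 s (le_of_lt hs)
      rw [this.iteratedDeriv_eq]
      simp
    rw [e1, integral_eq_intervalIntegral_of_tsupport (a := -τ) (b := τ) (by linarith)
      (fun t ht => by
        simp only [mem_Ioc, not_and_or, not_lt, not_le] at ht
        rcases ht with ht | ht
        · rw [hz2 t ht, zero_mul]
        · rw [hz1 t ht.le, zero_mul]),
      ← intervalIntegral.integral_add_adjacent_intervals
        ((hψn.fun_mul (hc.fun_sub hpc)).intervalIntegrable (-τ) 0)
        ((hψn.fun_mul (hc.fun_sub hpc)).intervalIntegrable 0 τ)]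
    have e2 : ∫ s in (-τ)..0, iteratedDeriv n ψ s * (l (f s x) - p.eval (s : ℂ)) = 0 := by
      rw [intervalIntegral.integral_congr (g := fun _ => 0)]
      · simp
      · intro s hs
        rw [uIcc_of_le (by linarith)] at hs
        simp [hp1 s hs]
    rw [e2, zero_add]
    congr 1
    refine intervalIntegral.integral_congr fun s hs => ?_
    rw [uIcc_of_le hτ.le] at hs
    simp only [max_eq_right hs.1, sub_apply, map_sub, hp2,
      eventuallyEq_iteratedDeriv_of_Ici hψ1 n (show -(τ / 4) < s by linarith [hs.1])]

/-- Integration by parts against the primitive of `S`, whose value at `0` is zero. -/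
theorem IsDerivativeOf.exists_succ [UniformSpace E] [IsUniformAddGroup E] [ContinuousSMul ℂ E]
    [T2Space E] [Module ℝ E] [IsScalarTower ℝ ℂ E] [LocallyConvexSpace ℝ E] [BarrelledSpace ℂ E]
    (hE : IsSeqComplete E)
    {n : ℕ} {τ : ℝ} {G : TestFn →L[ℂ] (E →L[ℂ] E)} {S : ℝ → (E →L[ℂ] E)}
    (h : IsDerivativeOf n τ G S) : ∃ F : ℝ → (E →L[ℂ] E), IsDerivativeOf (n + 1) τ G F := by
  obtain ⟨F, hFc, hF⟩ := exists_operator_integral hE h.continuous_apply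
  refine ⟨F, hFc, fun φ hφ x l => ?_⟩
  have hc : Continuous fun s => l (S s x) := l.continuous.comp (h.continuous_apply x)
  have hd : ∀ t, HasDerivAt (fun t => l (F t x)) (l (S t x)) t := fun t => by
    simp only [hF]
    exact (hc.integral_hasStrictDerivAt 0 t).hasDerivAt
  have h0 : l (F 0 x) = 0 := by simp [hF]
  rw [h.apply_eq φ hφ, integral_iteratedDeriv_succ_mul φ.smooth
    (eq_zero_of_tsupport_subset_Iio hφ) hd hc, h0]
  ring

end Representation

/-! ### Properties of the representing family -/

theorem gFun_natCast_succ (k : ℕ) (t : ℝ) : gFun ((k : ℝ) + 1) t = dividedPow k t := by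
  simp [gFun, dividedPow, Real.Gamma_nat_eq_factorial]

theorem truncConv_eq_zero_of_le {f g : ℝ → ℂ} {a b : ℝ} (ha : 0 ≤ a) (hb : 0 ≤ b)
    (hf : ∀ t, a ≤ t → f t = 0) (hg : ∀ t, b ≤ t → g t = 0) (t : ℝ) (ht : a + b ≤ t) :
    truncConv f g t = 0 := by
  rw [truncConv, intervalIntegral.integral_congr (g := fun _ => 0)]
  · simp
  · intro s hs
    rw [uIcc_of_le ((add_nonneg ha hb).trans ht)] at hs
    rcases le_total b s with h | h
    · simp [hg s h]
    · simp [hf (t - s) (by linarith)]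

theorem TestFn.zeroConv_comm (φ ψ : TestFn) : φ.zeroConv ψ = ψ.zeroConv φ :=
  TestFunction.ext fun t => truncConv_comm φ ψ t

/-- Differentiate `φ *₀ ψ` with the derivative on either factor; `φ 0 = 0` removes one of the two
boundary terms. -/
theorem TestFn.derivative_zeroConv (φ ψ : TestFn) (hφ : φ 0 = 0) :
    φ.derivative.zeroConv ψ = φ.zeroConv ψ.derivative + ψ 0 • φ := by
  refine TestFunction.ext fun t => ?_
  have h1 := (hasDerivAt_truncConv φ.smooth ψ.smooth.continuous t).deriv
  have h2 := (hasDerivAt_truncConv ψ.smooth φ.smooth.continuous t).deriv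
  rw [← funext (truncConv_comm φ ψ), h1, hφ] at h2
  simp only [zero_mul, zero_add] at h2
  simp only [coe_zeroConv, coe_derivative, add_apply, FunLike.coe_smul, Pi.smul_apply, smul_eq_mul,
    h2, truncConv_comm φ]
  ring

theorem TestFn.exists_iteratedDeriv_zero_eq {τ : ℝ} (hτ : 0 < τ) (i : ℕ) :
    ∃ φ : TestFn, tsupport φ ⊆ Ioo (-τ) τ ∧
      ∀ j, iteratedDeriv j φ 0 = if j = i then 1 else 0 := by
  obtain ⟨χ, hχ, h0, h1⟩ := exists_smooth_step (a := τ / 4) (b := τ / 2) (by linarith)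
  obtain ⟨φ, hφ, hj⟩ := exists_testFn_iteratedDeriv_eq (b := τ / 2)
    ((contDiff_dividedPow i).mul (contDiff_const.sub hχ : ContDiff ℝ _ fun t => 1 - χ t)) hτ
    (by linarith) (fun t ht => by simp [h1 t ht]) 0
  refine ⟨φ, hφ, fun j => ?_⟩
  have h2 := hj j 0 le_rfl
  rw [zero_add] at h2
  have h3 : (fun t => dividedPow i t * (1 - χ t)) =ᶠ[𝓝 0] dividedPow i := by
    filter_upwards [Iio_mem_nhds (show 0 < τ / 4 by linarith)] with s hs
    simp [h0 s (le_of_lt hs)]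
  rw [h2, Filter.EventuallyEq.iteratedDeriv_eq j h3]
  rcases lt_trichotomy j i with h | h | h
  · obtain ⟨d, rfl⟩ := Nat.exists_eq_add_of_lt h
    rw [show j + d + 1 = (d + 1) + j by ring, iteratedDeriv_dividedPow, dividedPow_succ_zero,
      if_neg (by omega)]
  · subst h
    have := iteratedDeriv_dividedPow 0 j
    rw [zero_add] at this
    rw [this, dividedPow_zero_left, if_pos rfl]
  · rw [iteratedDeriv_dividedPow_of_lt h, if_neg (by omega)]
    rfl

section Properties

variable {E : Type*} [AddCommGroup E] [Module ℂ E]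

section TopologicalVectorSpace

variable [TopologicalSpace E] [IsTopologicalAddGroup E] [ContinuousSMul ℂ E]
  {C : E →L[ℂ] E} {G : TestFn →L[ℂ] (E →L[ℂ] E)} {S : ℝ → (E →L[ℂ] E)} {n k : ℕ} {τ : ℝ}

theorem IsPreCDS.apply_apply (hG : IsPreCDS C G) (φ ψ : TestFn) (x : E) :
    G φ (G ψ x) = G (φ.zeroConv ψ) (C x) :=
  (DFunLike.congr_fun (hG.zeroConv_comp φ ψ) x).symm

theorem IsDerivativeOf.continuous_functional (h : IsDerivativeOf n τ G S) (x : E)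
    (l : E →L[ℂ] ℂ) : Continuous fun t => l (S t x) :=
  l.continuous.comp (h.continuous_apply x)

theorem IsDerivativeOf.apply_eq_of_tsupport (h : IsDerivativeOf n τ G S) {φ : TestFn} {a : ℝ}
    (haτ : a ≤ τ) (hφ : tsupport φ ⊆ Ioo (-a) a) (x : E) (l : E →L[ℂ] ℂ) :
    l (G φ x) = (-1) ^ n * ∫ s in (0 : ℝ)..a, iteratedDeriv n φ s * l (S s x) := by
  rw [h.apply_eq φ fun t ht => (hφ ht).2.trans_le haτ,
    intervalIntegral_eq_of_eq_zero_of_le (((φ.smooth.iteratedDeriv_top n).continuous).fun_mul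
      (h.continuous_functional x l)) _ haτ]
  intro t ht
  rw [iteratedDeriv_eq_zero_of_le φ.smooth
    (fun s hs => eq_zero_of_tsupport_subset hφ fun hm => by linarith [hm.2]) n t ht, zero_mul]

theorem neg_one_pow_mul_self (n : ℕ) : (-1 : ℂ) ^ n * (-1) ^ n = 1 := by
  rw [← mul_pow]
  simp

/-! ### From relations for the distribution to relations for the family -/

theorem IsDerivativeOf.apply_zeroConv (h : IsDerivativeOf (k + 1) τ G S) {φ ψ : TestFn} {a b : ℝ}
    (ha : 0 < a) (hb : 0 < b) (hab : a + b < τ) (hφ : tsupport φ ⊆ Ioo (-a) a)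
    (hψ : tsupport ψ ⊆ Ioo (-b) b) (y : E) (l : E →L[ℂ] ℂ) :
    l (G (φ.zeroConv ψ) y) = ∫ s in (0 : ℝ)..b, iteratedDeriv (k + 1) ψ s *
      ∫ u in (0 : ℝ)..a, iteratedDeriv (k + 1) φ u * semigroupKernel k (fun r => l (S r y)) s u := by
  have hφ0 : ∀ t, a ≤ t → φ t = 0 := fun t ht =>
    eq_zero_of_tsupport_subset hφ fun hm => by linarith [hm.2]
  have hψ0 : ∀ t, b ≤ t → ψ t = 0 := fun t ht =>
    eq_zero_of_tsupport_subset hψ fun hm => by linarith [hm.2]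
  have hsupp : tsupport (φ.zeroConv ψ) ⊆ Iio τ := by
    have : tsupport (φ.zeroConv ψ) ⊆ Iic (a + b) := by
      refine closure_minimal (fun t ht => ?_) isClosed_Iic
      by_contra hn
      exact ht (truncConv_eq_zero_of_le ha.le hb.le hφ0 hψ0 t (le_of_lt (not_le.1 hn)))
    exact fun t ht => (this ht).trans_lt hab
  rw [h.apply_eq _ hsupp y l, TestFn.coe_zeroConv, integral_iteratedDeriv_truncConv_mul φ.smooth
    ψ.smooth (h.continuous_functional y l) hφ0 hψ0 ha.le hb.le hab.le]

/-- Half of the passage to the semigroup law: `φ` is kept, and `ψ` is removed from `G φ G ψ = G (φ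
*₀ ψ) C`. -/
theorem IsDerivativeOf.apply_comp_family (h : IsDerivativeOf (k + 1) τ G S) (hG : IsPreCDS C G)
    {φ : TestFn} {a b : ℝ} (ha : 0 < a) (hb : 0 < b) (hab : a + b < τ)
    (hφ : tsupport φ ⊆ Ioo (-a) a) (x : E) (l : E →L[ℂ] ℂ) {s : ℝ} (hs : s ∈ Ico 0 b) :
    (-1) ^ (k + 1) * l (G φ (S s x)) = ∫ u in (0 : ℝ)..a, iteratedDeriv (k + 1) φ u
        * semigroupKernel k (fun r => l (S r (C x))) s u := by
  have hR := continuous_semigroupKernel k (h.continuous_functional (C x) l)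
  obtain ⟨R, hRdef⟩ : ∃ R : ℝ → ℝ → ℂ, R = semigroupKernel k fun r => l (S r (C x)) := ⟨_, rfl⟩
  simp only [← hRdef] at hR ⊢
  have cφ := (φ.smooth.iteratedDeriv_top (k + 1)).continuous
  have hc1 : Continuous fun s => l (G φ (S s x)) := h.continuous_functional x (l.comp (G φ))
  have hc2 : Continuous fun s => ∫ u in (0 : ℝ)..a, iteratedDeriv (k + 1) φ u * R s u :=
    continuous_intervalIntegral_param (F := fun s u => iteratedDeriv (k + 1) φ u * R s u)
      ((cφ.comp continuous_snd).mul hR) continuous_const continuous_const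
  refine sub_eq_zero.1 (eqOn_zero_of_integral_iteratedDeriv_mul
    ((continuous_const.fun_mul hc1).fun_sub hc2) hb (k + 1) (fun ψ hψ _ => ?_) s hs)
  have cψ := (ψ.smooth.iteratedDeriv_top (k + 1)).continuous
  -- Absorbing `G φ` into the functional lets the representation of `G ψ` apply.
  have e1 := h.apply_eq_of_tsupport (by linarith : b ≤ τ) hψ x (l.comp (G φ))
  have e2 := h.apply_zeroConv ha hb hab hφ hψ (C x) l
  simp only [ContinuousLinearMap.comp_apply, hG.apply_apply] at e1
  rw [e2, ← hRdef] at e1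
  simp only [mul_sub]
  rw [intervalIntegral.integral_sub
    ((cψ.fun_mul (continuous_const.fun_mul hc1)).intervalIntegrable _ _)
    ((cψ.fun_mul hc2).intervalIntegrable _ _), e1, ← intervalIntegral.integral_const_mul,
    sub_eq_zero]
  exact intervalIntegral.integral_congr fun s _ => by ring

theorem IsDerivativeOf.apply_comp_eq_semigroupKernel (h : IsDerivativeOf (k + 1) τ G S)
    (hG : IsPreCDS C G) (x : E) {t s : ℝ} (ht : 0 ≤ t) (hs : 0 ≤ s) (hts : t + s < τ)
    (l : E →L[ℂ] ℂ) :
    l (S t (S s x)) = semigroupKernel k (fun r => l (S r (C x))) s t := by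
  obtain ⟨a, b, hta, hsb, hab⟩ : ∃ a b, t < a ∧ s < b ∧ a + b < τ :=
    ⟨t + (τ - t - s) / 3, s + (τ - t - s) / 3, by linarith, by linarith, by linarith⟩
  have ha : 0 < a := by linarith
  have hb : 0 < b := by linarith
  have hR := continuous_semigroupKernel k (h.continuous_functional (C x) l)
  have e0 := fun (φ : TestFn) (hφ : tsupport φ ⊆ Ioo (-a) a) =>
    h.apply_comp_family hG ha hb hab hφ x l ⟨hs, hsb⟩
  generalize semigroupKernel k (fun r => l (S r (C x))) = R at hR e0 ⊢
  have hc1 : Continuous fun u => l (S u (S s x)) := h.continuous_functional _ l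
  have hc2 : Continuous fun u => R s u :=
    hR.comp (continuous_const.prodMk continuous_id : Continuous fun u : ℝ => (s, u))
  refine sub_eq_zero.1 (eqOn_zero_of_integral_iteratedDeriv_mul (hc1.fun_sub hc2) ha (k + 1)
    (fun φ hφ _ => ?_) t ⟨ht, hta⟩)
  have cφ := (φ.smooth.iteratedDeriv_top (k + 1)).continuous
  have e := e0 φ hφ
  rw [h.apply_eq_of_tsupport (by linarith : a ≤ τ) hφ, ← mul_assoc, neg_one_pow_mul_self,
    one_mul] at e
  simp only [mul_sub]
  rw [intervalIntegral.integral_sub ((cφ.fun_mul hc1).intervalIntegrable _ _)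
    ((cφ.fun_mul hc2).intervalIntegrable _ _), e, sub_self]

theorem IsDerivativeOf.apply_comm (h : IsDerivativeOf n τ G S) (hG : IsPreCDS C G) (hτ : 0 < τ)
    (x : E) {t : ℝ} (ht : t ∈ Ico 0 τ) (l : E →L[ℂ] ℂ) : l (S t (C x)) = l (C (S t x)) := by
  have hc1 : Continuous fun u => l (S u (C x)) := l.continuous.comp (h.continuous_apply _)
  have hc2 : Continuous fun u => l (C (S u x)) :=
    l.continuous.comp (C.continuous.comp (h.continuous_apply _))
  refine sub_eq_zero.1 (eqOn_zero_of_integral_iteratedDeriv_mul (hc1.fun_sub hc2) hτ n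
    (fun φ hφ _ => ?_) t ht)
  have cφ := (φ.smooth.iteratedDeriv_top n).continuous
  have e1 := h.apply_eq_of_tsupport le_rfl hφ (C x) l
  have e2 := h.apply_eq_of_tsupport le_rfl hφ x (l.comp C)
  have e3 : C (G φ x) = G φ (C x) := DFunLike.congr_fun (hG.comm φ) x
  simp only [ContinuousLinearMap.comp_apply, e3] at e2
  rw [e1] at e2
  have e4 := mul_left_cancel₀ (pow_ne_zero n (by norm_num)) e2
  simp only [mul_sub]
  rw [intervalIntegral.integral_sub ((cφ.fun_mul hc1).intervalIntegrable _ _)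
    ((cφ.fun_mul hc2).intervalIntegrable _ _), e4, sub_self]

/-- The generator relation tested on `φ`. Apply `G` to `φ' *₀ ψ = φ *₀ ψ' + ψ(0) φ`, write every
term as an integral against the derivative of `ψ` of order `n + 1`, and remove `ψ`. -/
theorem IsDerivativeOf.integral_apply_derivative (h : IsDerivativeOf n τ G S) (hG : IsPreCDS C G)
    (hτ : 0 < τ) {φ : TestFn} (hφ : tsupport φ ⊆ Ici 0) (x : E) {t : ℝ} (ht : t ∈ Ico 0 τ)
    (l : E →L[ℂ] ℂ) :
    ∫ s in (0 : ℝ)..t, l (G φ.derivative (S s x))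
      = dividedPow n t * l (G φ (C x)) - l (G φ (S t x)) := by
  have hφ0 : φ 0 = 0 := by
    have h1 : ∀ t ∈ Iio (0 : ℝ), φ t = 0 := fun t ht =>
      eq_zero_of_tsupport_subset hφ (by simpa using ht)
    have h2 : closure (Iio (0 : ℝ)) ⊆ {t | φ t = 0} :=
      closure_minimal h1 (isClosed_eq φ.smooth.continuous continuous_const)
    rw [closure_Iio] at h2
    exact h2 (mem_Iic.2 le_rfl)
  have hc1 : Continuous fun s => l (G φ.derivative (S s x)) :=
    l.continuous.comp ((G φ.derivative).continuous.comp (h.continuous_apply x))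
  have hc2 : Continuous fun s => l (G φ (S s x)) :=
    l.continuous.comp ((G φ).continuous.comp (h.continuous_apply x))
  have hd : ∀ t, HasDerivAt (fun t => ∫ s in (0 : ℝ)..t, l (G φ.derivative (S s x)))
      (l (G φ.derivative (S t x))) t := fun t => (hc1.integral_hasStrictDerivAt 0 t).hasDerivAt
  have hcU : Continuous fun t => ∫ s in (0 : ℝ)..t, l (G φ.derivative (S s x)) :=
    continuous_iff_continuousAt.2 fun t => (hd t).continuousAt
  have hcp : Continuous fun t => dividedPow n t * l (G φ (C x)) :=
    (contDiff_dividedPow n).continuous.mul continuous_const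
  -- Order `n + 1`: `G ψ'` already involves it, `G ψ` reaches it through the primitive, and `ψ 0`
  -- through the monomial of degree `n`.
  have key := eqOn_zero_of_integral_iteratedDeriv_mul ((hcU.fun_add hc2).fun_sub hcp) hτ (n + 1)
    (fun ψ hψ _ => ?_) t ht
  · linear_combination key
  · have cψ := fun j => (ψ.smooth.iteratedDeriv_top j).continuous
    have hψ0 : ∀ t, τ ≤ t → ψ t = 0 := fun t ht =>
      eq_zero_of_tsupport_subset hψ fun hm => by linarith [hm.2]
    have hψ' : tsupport ψ.derivative ⊆ Ioo (-τ) τ := by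
      rw [TestFn.coe_derivative]
      exact tsupport_deriv_subset.trans hψ
    have e1 := h.apply_eq_of_tsupport le_rfl hψ x (l.comp (G φ.derivative))
    have e2 := h.apply_eq_of_tsupport le_rfl hψ' x (l.comp (G φ))
    have e3 : G φ.derivative (G ψ x) = G φ (G ψ.derivative x) + ψ 0 • G φ (C x) := by
      rw [hG.apply_apply, hG.apply_apply, TestFn.derivative_zeroConv φ ψ hφ0, map_add, map_smul]
      rfl
    have e4 := integral_iteratedDeriv_succ_mul ψ.smooth hψ0 hd hc1 n
    have e5 := eq_integral_iteratedDeriv_mul_dividedPow ψ.smooth hψ0 n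
    simp only [ContinuousLinearMap.comp_apply] at e1 e2
    rw [TestFn.coe_derivative, ← iteratedDeriv_succ'] at e2
    have e6 := congrArg l e3
    rw [map_add, map_smul, smul_eq_mul, e1, e2, e5] at e6
    simp only [mul_sub, mul_add]
    rw [intervalIntegral.integral_sub
      (((cψ _).fun_mul hcU).fun_add ((cψ _).fun_mul hc2) |>.intervalIntegrable _ _)
      (((cψ _).fun_mul hcp).intervalIntegrable _ _),
      Continuous.intervalIntegral_add ((cψ _).fun_mul hcU) ((cψ _).fun_mul hc2), e4]
    simp only [← mul_assoc, intervalIntegral.integral_mul_const, intervalIntegral.integral_same,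
      mul_zero, neg_zero, zero_sub]
    have e7 := neg_one_pow_mul_self n
    rw [pow_succ] at e6
    linear_combination (-(-1) ^ n) * e6 + ((∫ s in (0 : ℝ)..τ, iteratedDeriv n ψ s *
      l (G φ.derivative (S s x))) - (∫ s in (0 : ℝ)..τ, iteratedDeriv (n + 1) ψ s *
      l (G φ (S s x))) + (∫ s in (0 : ℝ)..τ, iteratedDeriv (n + 1) ψ s * dividedPow n s)
        * l (G φ (C x))) * e7

theorem IsDerivativeOf.hasSetIntegral (h : IsDerivativeOf n τ G S) (hτ : 0 < τ) {φ : TestFn}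
    (hφ : tsupport φ ⊆ Ioo (-τ) τ) (x : E) :
    HasSetIntegral (Ico 0 τ) (fun s => iteratedDeriv n φ s • S s x) ((-1 : ℂ) ^ n • G φ x) := by
  intro l
  have hc : Continuous fun s => l (iteratedDeriv n φ s • S s x) :=
    l.continuous.comp ((φ.smooth.iteratedDeriv_top n).continuous.smul (h.continuous_apply x))
  refine ⟨hc.integrableOn_Icc.mono_set Ico_subset_Icc_self, ?_⟩
  rw [integral_Ico_eq_integral_Ioo, ← integral_Ioc_eq_integral_Ioo,
    ← intervalIntegral.integral_of_le hτ.le, map_smul, h.apply_eq_of_tsupport le_rfl hφ, smul_eq_mul,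
    ← mul_assoc, neg_one_pow_mul_self, one_mul]
  simp

/-! ### The restriction to the kernel space -/

/-- The operators `G φ` commute with each other, because `*₀` is commutative. -/
theorem IsPreCDS.apply_mem_kernelSpace (hG : IsPreCDS C G) (φ : TestFn) {x : E}
    (hx : x ∈ kernelSpace G) : G φ x ∈ kernelSpace G := fun ψ hψ => by
  rw [hG.apply_apply, TestFn.zeroConv_comm, ← hG.apply_apply, hx ψ hψ, map_zero]

/-- The restriction of a pre-(C-DS) to its kernel space, as a linear map. -/
noncomputable def IsPreCDS.kernelRestrictₗ (hG : IsPreCDS C G) :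
    TestFn →ₗ[ℂ] (kernelSpace G →L[ℂ] kernelSpace G) where
  toFun φ := ((G φ).comp (kernelSpace G).subtypeL).codRestrict (kernelSpace G)
    fun x => hG.apply_mem_kernelSpace φ x.2
  map_add' φ ψ := by
    ext x
    change G (φ + ψ) x = G φ x + G ψ x
    rw [map_add]
    rfl
  map_smul' c φ := by
    ext x
    change G (c • φ) x = c • G φ x
    rw [map_smul]
    rfl

/-- The restriction of a pre-(C-DS) to its kernel space. -/
noncomputable def IsPreCDS.kernelRestrict (hG : IsPreCDS C G) :
    TestFn →L[ℂ] (kernelSpace G →L[ℂ] kernelSpace G) where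
  toLinearMap := hG.kernelRestrictₗ
  cont := by
    refine continuous_of_continuousAt_zero hG.kernelRestrictₗ ?_
    rw [ContinuousAt, map_zero]
    -- Bounded subsets of `N` are bounded in `E`, and neighbourhoods in `N` are traces of
    -- neighbourhoods in `E`.
    refine ContinuousLinearMap.hasBasis_nhds_zero.tendsto_right_iff.2 ?_
    rintro ⟨B, V⟩ ⟨hB, hV⟩
    rw [nhds_subtype_eq_comap, mem_comap] at hV
    obtain ⟨U, hU, hUV⟩ := hV
    have hB' : Bornology.IsVonNBounded ℂ ((kernelSpace G).subtypeL '' B) := hB.image _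
    have hm : {A : E →L[ℂ] E | ∀ x ∈ (kernelSpace G).subtypeL '' B, A x ∈ U}
        ∈ 𝓝 (0 : E →L[ℂ] E) :=
      ContinuousLinearMap.hasBasis_nhds_zero.mem_of_mem (i := (_, U)) ⟨hB', hU⟩
    have := G.continuous.tendsto 0
    rw [map_zero] at this
    filter_upwards [this hm] with φ hφ x hx
    exact hUV (hφ x ⟨x, hx, rfl⟩)

@[simp]
theorem IsPreCDS.coe_kernelRestrict_apply (hG : IsPreCDS C G) (φ : TestFn) (x : kernelSpace G) :
    (hG.kernelRestrict φ x : E) = G φ x := rfl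

/-- A test function vanishing near `0` can be cut off to one supported in `[0, ∞)` without changing
`G`, and such functions annihilate `N` by definition. -/
theorem IsPreCDS.isVanishingOn_kernelRestrict (hG : IsPreCDS C G) :
    Distribution.IsVanishingOn hG.kernelRestrict ({0}ᶜ : Set ℝ) := by
  intro φ hφ
  have h0 : ⇑φ =ᶠ[𝓝 0] 0 := notMem_tsupport_iff_eventuallyEq.1 fun h => hφ h rfl
  obtain ⟨ε, hε, h⟩ := Metric.eventually_nhds_iff.1 h0
  obtain ⟨ψ, hψ0, hψ1, hψs⟩ := φ.exists_cutoff (a := -(ε / 2)) (b := ε / 2) (by linarith)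
  have hz : ∀ t, |t| < ε → φ t = 0 ∧ ψ t = 0 := fun t ht => by
    have hev : ⇑φ =ᶠ[𝓝 t] 0 := by
      filter_upwards [(isOpen_lt continuous_abs continuous_const).mem_nhds ht] with s hs
      exact h (by rwa [dist_zero_right])
    refine ⟨hev.self_of_nhds, image_eq_zero_of_notMem_tsupport fun hm => ?_⟩
    exact notMem_tsupport_iff_eventuallyEq.2 hev (hψs hm)
  ext x
  rw [hG.coe_kernelRestrict_apply, hG.support_subset.congr_of_Ici (ψ := ψ)
    (show 0 < ε / 2 by linarith) fun t ht => ?_]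
  · refine x.2 ψ (closure_minimal (fun t ht => ?_) isClosed_Ici)
    by_contra hn
    rw [mem_Ici, not_le] at hn
    refine ht ?_
    by_cases h1 : t ≤ -(ε / 2)
    · exact hψ0 t h1
    · exact (hz t (abs_lt.2 ⟨by linarith, by linarith⟩)).2
  · by_cases h1 : ε / 2 ≤ t
    · exact (hψ1 t h1).symm
    · have := hz t (abs_lt.2 ⟨by linarith, by linarith⟩)
      rw [this.1, this.2]

theorem IsPreCDS.exists_isDeltaExpansion (hG : IsPreCDS C G)
    (hadm : IsAdmissible (kernelSpace G →L[ℂ] kernelSpace G)) (N : ℕ) :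
    ∃ (m : ℕ) (T : ℕ → (kernelSpace G →L[ℂ] kernelSpace G)), N ≤ m ∧ IsDeltaExpansion G m T := by
  obtain ⟨m, T, hT⟩ := hadm hG.kernelRestrict hG.isVanishingOn_kernelRestrict
  -- Padding by zero operators makes the expansion as long as required.
  refine ⟨max m N, fun j => if j ≤ m then T j else 0, le_max_right _ _, fun φ x => ?_⟩
  have h1 : (G φ x : E) = ∑ j ∈ Finset.range (m + 1),
      ((-1 : ℂ) ^ j * iteratedDeriv j φ 0) • (T j x : E) := by
    rw [← hG.coe_kernelRestrict_apply, hT]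
    simp [sum_apply]
  rw [h1]
  have hsub : Finset.range (m + 1) ⊆ Finset.range (max m N + 1) :=
    Finset.range_mono (Nat.succ_le_succ (le_max_left _ _))
  rw [← Finset.sum_subset hsub]
  · refine Finset.sum_congr rfl fun j hj => ?_
    simp only
    rw [if_pos (Nat.lt_succ_iff.1 (Finset.mem_range.1 hj))]
  · intro j _ hj
    simp only
    rw [if_neg fun hle => hj (Finset.mem_range.2 (Nat.lt_succ_iff.2 hle))]
    simp

end TopologicalVectorSpace

variable [UniformSpace E] [IsUniformAddGroup E] [ContinuousSMul ℂ E] [T2Space E] [Module ℝ E]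
  [IsScalarTower ℝ ℂ E] [LocallyConvexSpace ℝ E]
  {C : E →L[ℂ] E} {G : TestFn →L[ℂ] (E →L[ℂ] E)} {S : ℝ → (E →L[ℂ] E)} {n k : ℕ} {τ : ℝ}

theorem IsDerivativeOf.isIntegratedCSemigroup (h : IsDerivativeOf (k + 1) τ G S)
    (hE : IsSeqComplete E) (hG : IsPreCDS C G) (hτ : 0 < τ) :
    IsIntegratedCSemigroup C ((k + 1 : ℕ) : ℝ) τ S where
  stronglyContinuous x := (h.continuous_apply x).continuousOn
  comm t ht := by
    ext x
    exact eq_of_forall_apply_eq fun l => h.apply_comm hG hτ x ht l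
  semigroup x t ht s hs hts := by
    have hc : Continuous fun r => gFun ((k + 1 : ℕ) : ℝ) (t + s - r) • S r (C x) := by
      simp only [Nat.cast_add, Nat.cast_one, gFun_natCast_succ]
      exact ((contDiff_dividedPow k).continuous.comp (by fun_prop)).smul (h.continuous_apply _)
    obtain ⟨a, ha, ha'⟩ := exists_hasSetIntegral_Icc hE hc hts.1
    obtain ⟨b, hb, hb'⟩ := exists_hasSetIntegral_Icc hE hc ht.1
    obtain ⟨c, hc, hc'⟩ := exists_hasSetIntegral_Icc hE hc hs.1
    refine ⟨a, b, c, ha, hb, hc, eq_of_forall_apply_eq fun l => ?_⟩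
    rw [h.apply_comp_eq_semigroupKernel hG x ht.1 hs.1 hts.2, map_sub, map_sub, ha', hb', hc',
      semigroupKernel_eq k (h.continuous_functional (C x) l)]
    simp only [map_smul, smul_eq_mul, Nat.cast_add, Nat.cast_one, gFun_natCast_succ]

theorem IsDerivativeOf.isIntegratedCExistenceFamily (h : IsDerivativeOf n τ G S)
    (hE : IsSeqComplete E) (hG : IsPreCDS C G) (hτ : 0 < τ) :
    IsIntegratedCExistenceFamily C n τ S (generator G) where
  stronglyContinuous x := (h.continuous_apply x).continuousOn
  integral_mem x t ht := by
    obtain ⟨v, hv, hv'⟩ := exists_hasSetIntegral_Icc hE (h.continuous_apply x) ht.1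
    refine ⟨v, hv, fun φ hφ => eq_of_forall_apply_eq fun l => ?_⟩
    have e1 := hv' (l.comp (G φ.derivative))
    simp only [ContinuousLinearMap.comp_apply] at e1
    rw [h.integral_apply_derivative hG hτ hφ x ht] at e1
    simp only [gFun_natCast_succ, map_neg, map_sub, map_smul, neg_apply, e1, smul_eq_mul]
    ring

/-- Forwards, a test function whose only nonzero derivative at `0` is the `i`-th isolates `T i x`;
`n ≤ m + 1` ensures that this term occurs. Backwards, test functions flat at `0` from order `n` on
see only the `T j x` with `j < n`. -/
theorem IsDerivativeOf.forall_apply_eq_zero_iff (h : IsDerivativeOf n τ G S) (hτ : 0 < τ) {m : ℕ}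
    {T : ℕ → (kernelSpace G →L[ℂ] kernelSpace G)} (hnm : n ≤ m + 1) (hT : IsDeltaExpansion G m T)
    (x : kernelSpace G) : (∀ t ∈ Ico 0 τ, S t (x : E) = 0) ↔ ∀ i < n, T i x = 0 := by
  constructor
  · intro hS i hi
    obtain ⟨φ, hφ, hj⟩ := TestFn.exists_iteratedDeriv_zero_eq hτ i
    have h1 : G φ (x : E) = 0 := eq_of_forall_apply_eq fun l => by
      have h2 := (h.hasSetIntegral hτ hφ (x : E) l).2
      rw [setIntegral_eq_zero_of_forall_eq_zero fun t ht => by simp [hS t ht]] at h2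
      have h3 : ((-1 : ℂ) ^ n) ≠ 0 := pow_ne_zero _ (by norm_num)
      simpa [h3] using h2.symm
    rw [hT φ x, Finset.sum_eq_single i] at h1
    · rw [hj, if_pos rfl, mul_one] at h1
      have h3 : ((-1 : ℂ) ^ i) ≠ 0 := pow_ne_zero _ (by norm_num)
      simpa [h3] using h1
    · intro j _ hji
      simp [hj, hji]
    · intro hn
      exact absurd (Finset.mem_range.2 (by omega)) hn
  · intro hTi t ht
    refine eq_of_forall_apply_eq fun l => ?_
    rw [map_zero]
    refine eqOn_zero_of_integral_iteratedDeriv_mul (l.continuous.comp (h.continuous_apply x)) hτ n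
      (fun φ hφ hφ0 => ?_) t ht
    have h1 := h.apply_eq_of_tsupport le_rfl hφ (x : E) l
    have h2 : G φ (x : E) = 0 := by
      rw [hT φ x]
      refine Finset.sum_eq_zero fun j _ => ?_
      by_cases hjn : j < n
      · simp [hTi j hjn]
      · simp [hφ0 j (not_lt.1 hjn)]
    rw [h2, map_zero] at h1
    have h3 : ((-1 : ℂ) ^ n) ≠ 0 := pow_ne_zero _ (by norm_num)
    exact (mul_eq_zero.1 h1.symm).resolve_left h3

end Properties

theorem theorem4p2 {E : Type*} [AddCommGroup E] [Module ℂ E] [UniformSpace E]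
    [IsUniformAddGroup E] [ContinuousSMul ℂ E] [T2Space E]
    [Module ℝ E] [IsScalarTower ℝ ℂ E] [LocallyConvexSpace ℝ E] [BarrelledSpace ℂ E]
    (hE : IsSeqComplete E)
    (C : E →L[ℂ] E) (G : TestFn →L[ℂ] (E →L[ℂ] E))
    (hG : IsPreCDS C G) (hfin : IsOfFiniteOrder G) :
    ∀ τ : ℝ, 0 < τ → ∃ (n : ℕ) (S : ℝ → (E →L[ℂ] E)), 0 < n ∧
      IsIntegratedCSemigroup C n τ S ∧
      (∀ φ : TestFn, tsupport φ ⊆ Ioo (-τ) τ → ∀ x : E,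
        ∃ v : E, HasSetIntegral (Ico 0 τ) (fun s => iteratedDeriv n φ s • S s x) v ∧
          G φ x = (-1 : ℂ) ^ n • v) ∧
      IsIntegratedCExistenceFamily C n τ S (generator G) ∧
      (IsAdmissible (kernelSpace G →L[ℂ] kernelSpace G) →
        (∃ (m : ℕ) (T : ℕ → (kernelSpace G →L[ℂ] kernelSpace G)),
          n ≤ m + 1 ∧ IsDeltaExpansion G m T) ∧
        ∀ (m : ℕ) (T : ℕ → (kernelSpace G →L[ℂ] kernelSpace G)),
          n ≤ m + 1 → IsDeltaExpansion G m T →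
          ∀ x : kernelSpace G,
            (∀ t ∈ Ico 0 τ, S t (x : E) = 0) ↔ ∀ i < n, T i x = 0) := by
  intro τ hτ
  obtain ⟨k, S₀, hS₀⟩ := exists_isDerivativeOf_of_isOfFiniteOrder hG.support_subset hfin hτ
  -- The order `k` may be zero, so one integration is made to reach `n = k + 1 ≥ 1`.
  obtain ⟨S, hS⟩ := hS₀.exists_succ hE
  refine ⟨k + 1, S, k.succ_pos, hS.isIntegratedCSemigroup hE hG hτ,
    fun φ hφ x => ⟨_, hS.hasSetIntegral hτ hφ x, ?_⟩,
    hS.isIntegratedCExistenceFamily hE hG hτ, fun hadm => ⟨?_, fun m T hm hT x =>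
      hS.forall_apply_eq_zero_iff hτ hm hT x⟩⟩
  · rw [smul_smul, neg_one_pow_mul_self, one_smul]
  · obtain ⟨m, T, hkm, hT⟩ := hG.exists_isDeltaExpansion hadm k
    exact ⟨m, T, Nat.succ_le_succ hkm, hT⟩
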